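/- Let $(\mathcal X,\mathcal A,\mu_X)$ and $(\mathcal Y,\mathcal B,\mu_Y)$ be separable $\sigma$-finite measure spaces, let $\mu=\mu_X\otimes\mu_Y$, and let $(p^X_j)_{j\in\mathcal J}$ and $(p^Y_k)_{k\in\mathcal K}$ be orthonormal bases of $L^2(\mu_X)$ and $L^2(\mu_Y)$, consisting of measurable real functions and indexed by countable sets; write $p_{jk}(x,y)=p^X_j(x)p^Y_k(y)$. Let $\mathcal F$ be the set of probability densities $f\in L^2(\mu)$. For $f\in\mathcal F$ with marginal densities $f_X,f_Y$ put $a_{jk}=\int f p_{jk}\,d\mu$, $a_{j\bullet}=\int f_Xp^X_j\,d\mu_X$, $a_{\bullet k}=\int f_Yp^Y_k\,d\mu_Y$, and $$D(f)=\int (f-f_Xf_Y)^2\,d\mu .$$ For $\theta=(\theta_{jk})\in[0,\infty]^{\mathcal J\times\mathcal K}$ (with $\infty\cdot 0=0$), $r\in(0,\infty)$, $A\in[1,\infty)$, $\xi=(\theta,r,A)$ and $\rho>0$ put $$S_\theta(f)=\sum_{j,k}\theta_{jk}^2(a_{jk}-a_{j\bullet}a_{\bullet k})^2,$$ $$\mathcal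 F_\xi(\rho)=\bigl\{f\in\mathcal F: D(f)\ge\rho^2,\ S_\theta(f)\le r^2,\ \max(\|f\|_\infty,\|f_X\|_\infty,\|f_Y\|_\infty)\le A\bigr\},$$ where $\|\cdot\|_\infty$ denotes the (pointwise) supremum norm. For $n\in\mathbb N$ and $\alpha\in(0,1)$ let $\Psi(\alpha)$ be the set of measurable $\psi:(\mathcal X\times\mathcal Y)^n\to[0,1]$ with $\mathbb E_P\psi\le\alpha$ for every distribution $P$ on $\mathcal X\times\mathcal Y$ of a pair with independent coordinates, where the expectation is that of $\psi$ applied to $n$ independent observations from $P$. For $\beta\in(0,1-\alpha)$ define the minimax separation radius $$\rho^*(n,\alpha,\beta,\xi)=\inf\Bigl\{\rho>0:\ \alpha+\inf_{\psi\in\Psi(\alpha)}\ \sup_{f\in\mathcal F_\xi(\rho)}\mathbb E_f(1-\psi)\le\alpha+\beta\Bigr\},$$ where a supremum over the empty set is $0$. For $\mathcal M\subseteq\mathcal J\times\mathcal K$ let $$h_{\mathcal M}\bigl((x_1,y_1),\dots,(x_4,y_4)\bigr)=\sum_{(j,k)\in\mathcal M}\bigl\{p_{jk}(x_1,y_1)p_{jk}(x_2,y_2)-2p_{jk}(x_1,y_1)p_{jk}(x_2,y_3)+p_{jk}(x_1,y_2)p_{jk}(x_3,y_4)\bigr\},$$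 where $\|h_{\mathcal M}\|_\infty:=\infty$ if the series does not converge unconditionally at every point. **Theorem.** Let $\alpha,\beta\in(0,1)$ with $\alpha+\beta<1$ and let $A\ge1$. There is a constant $C=C(\alpha,\beta,A)>0$, depending on nothing else, such that for all spaces and bases as above, all $\xi=(\theta,r,A)$ and all $n\ge16$, $$\rho^*(n,\alpha,\beta,\xi)\le C\inf_{\mathcal M\subseteq\mathcal J\times\mathcal K}\max\Bigl\{\frac{r}{\inf\{\theta_{jk}:(j,k)\notin\mathcal M\}},\ \frac{\min(\|h_{\mathcal M}\|_\infty^{1/2},|\mathcal M|^{1/4})}{n^{1/2}},\ \frac1{n^{1/2}}\Bigr\},$$ with $\inf\emptyset=\infty$, $r/\infty=0$, $r/0=\infty$. -/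

import Mathlib

open MeasureTheory ProbabilityTheory Set
open scoped ENNReal

noncomputable section

namespace IndepTest

/-- The functions `p i : Z → ℝ` are measurable, square integrable, and their classes form an
orthonormal basis of the Hilbert space `L²(ν)`. -/
structure IsL2Basis {Z ι : Type*} [MeasurableSpace Z] (ν : Measure Z) (p : ι → Z → ℝ) : Prop where
  measurable : ∀ i, Measurable (p i)
  memLp : ∀ i, MemLp (p i) 2 ν
  orthonormal : Orthonormal ℝ (fun i => (memLp i).toLp (p i))
  dense_span :
    (Submodule.span ℝ (Set.range fun i => (memLp i).toLp (p i))).topologicalClosure = ⊤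

/-- The sup norm `‖f‖_∞ = sup_z |f z| ∈ [0,∞]` (a pointwise supremum). -/
def supNorm {Z : Type*} (f : Z → ℝ) : ℝ≥0∞ := ⨆ z, ‖f z‖ₑ

variable {X Y J K : Type*} [MeasurableSpace X] [MeasurableSpace Y]

/-- `f` is a square integrable probability density on `X × Y` with respect to `μX ⊗ μY`.
(The Bochner integral of a non-integrable function is `0`, so the last clause gives
integrability.) -/
def IsDensity (μX : Measure X) (μY : Measure Y) (f : X × Y → ℝ) : Prop :=
  MemLp f 2 (μX.prod μY) ∧ 0 ≤ᵐ[μX.prod μY] f ∧ ∫ z, f z ∂(μX.prod μY) = 1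

/-- The marginal density of the first coordinate. -/
def margX (μY : Measure Y) (f : X × Y → ℝ) (x : X) : ℝ := ∫ y, f (x, y) ∂μY

/-- The marginal density of the second coordinate. -/
def margY (μX : Measure X) (f : X × Y → ℝ) (y : Y) : ℝ := ∫ x, f (x, y) ∂μX

/-- The measure of dependence `D(f) = ∫ (f - f_X f_Y)² dμ`. -/
def dependence (μX : Measure X) (μY : Measure Y) (f : X × Y → ℝ) : ℝ :=
  ∫ z, (f z - margX μY f z.1 * margY μX f z.2) ^ 2 ∂(μX.prod μY)

/-- The coefficient `a_{jk}(f)`. -/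
def coef (μX : Measure X) (μY : Measure Y) (pX : J → X → ℝ) (pY : K → Y → ℝ)
    (f : X × Y → ℝ) (j : J) (k : K) : ℝ :=
  ∫ z, f z * (pX j z.1 * pY k z.2) ∂(μX.prod μY)

/-- The coefficient `a_{j•}(f)`. -/
def coefX (μX : Measure X) (μY : Measure Y) (pX : J → X → ℝ) (f : X × Y → ℝ) (j : J) : ℝ :=
  ∫ x, margX μY f x * pX j x ∂μX

/-- The coefficient `a_{•k}(f)`. -/
def coefY (μX : Measure X) (μY : Measure Y) (pY : K → Y → ℝ) (f : X × Y → ℝ) (k : K) : ℝ :=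
  ∫ y, margY μX f y * pY k y ∂μY

/-- The smoothness functional `S_θ(f) = ∑_{j,k} θ_{jk}² (a_{jk} - a_{j•} a_{•k})² ∈ [0,∞]`,
for weights `θ_{jk} ∈ [0,∞]`, with `∞ * 0 = 0`. -/
def smoothness (μX : Measure X) (μY : Measure Y) (pX : J → X → ℝ) (pY : K → Y → ℝ)
    (θ : J → K → ℝ≥0∞) (f : X × Y → ℝ) : ℝ≥0∞ :=
  ∑' j, ∑' k, θ j k ^ 2 * ENNReal.ofReal
    ((coef μX μY pX pY f j k - coefX μX μY pX f j * coefY μX μY pY f k) ^ 2)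

/-- The class of alternatives `𝓕_ξ(ρ)`, `ξ = (θ, r, A)`. -/
def altClass (μX : Measure X) (μY : Measure Y) (pX : J → X → ℝ) (pY : K → Y → ℝ)
    (θ : J → K → ℝ≥0∞) (r A ρ : ℝ) : Set (X × Y → ℝ) :=
  {f | IsDensity μX μY f ∧ ρ ^ 2 ≤ dependence μX μY f ∧
    smoothness μX μY pX pY θ f ≤ ENNReal.ofReal (r ^ 2) ∧
    supNorm f ≤ ENNReal.ofReal A ∧ supNorm (margX μY f) ≤ ENNReal.ofReal A ∧
    supNorm (margY μX f) ≤ ENNReal.ofReal A}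

/-- The distribution on `X × Y` with density `f`. -/
def law (μX : Measure X) (μY : Measure Y) (f : X × Y → ℝ) : Measure (X × Y) :=
  (μX.prod μY).withDensity fun z => ENNReal.ofReal (f z)

/-- Expectation of a statistic of `n` independent observations with distribution `P`. -/
def expect {n : ℕ} (P : Measure (X × Y)) (ψ : (Fin n → X × Y) → ℝ) : ℝ :=
  ∫ z, ψ z ∂(Measure.pi fun _ : Fin n => P)

/-- The distributions of pairs with independent coordinates. -/
def nullLaws (X Y : Type*) [MeasurableSpace X] [MeasurableSpace Y] : Set (Measure (X × Y)) :=
  {P | IsProbabilityMeasure P ∧ IndepFun Prod.fst Prod.snd P}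

/-- `Ψ(α)`: the randomised tests `ψ : (X × Y)ⁿ → [0,1]` of size at most `α` over all
distributions of pairs with independent coordinates. -/
def validTests (X Y : Type*) [MeasurableSpace X] [MeasurableSpace Y] (n : ℕ) (α : ℝ) :
    Set ((Fin n → X × Y) → ℝ) :=
  {ψ | Measurable ψ ∧ (∀ z, ψ z ∈ Icc (0 : ℝ) 1) ∧ ∀ P ∈ nullLaws X Y, expect P ψ ≤ α}

/-- The minimax risk `α + inf_{ψ ∈ Ψ(α)} sup_{f ∈ 𝓕_ξ(ρ)} E_f(1 - ψ)`. All expectations lie in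
`[0,1]`, and the supremum over an empty class of alternatives is `0`. -/
def minimaxRisk (μX : Measure X) (μY : Measure Y) (pX : J → X → ℝ) (pY : K → Y → ℝ)
    (θ : J → K → ℝ≥0∞) (r A : ℝ) (n : ℕ) (α ρ : ℝ) : ℝ :=
  α + ⨅ ψ : validTests X Y n α, ⨆ f : altClass μX μY pX pY θ r A ρ,
    expect (law μX μY f.1) fun z => 1 - ψ.1 z

/-- The minimax separation radius
`ρ*(n, α, β, ξ) = inf {ρ > 0 : risk(n, α, ξ, ρ) ≤ α + β} ∈ [0,∞]`. -/
def separation (μX : Measure X) (μY : Measure Y) (pX : J → X → ℝ) (pY : K → Y → ℝ)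
    (θ : J → K → ℝ≥0∞) (r A : ℝ) (n : ℕ) (α β : ℝ) : ℝ≥0∞ :=
  ⨅ ρ ∈ {ρ : ℝ | 0 < ρ ∧ minimaxRisk μX μY pX pY θ r A n α ρ ≤ α + β}, ENNReal.ofReal ρ

/-- The `(j,k)`-summand of the kernel of the `U`-statistic, at four points `z i = (x_i, y_i)`. -/
def kernelTerm (pX : J → X → ℝ) (pY : K → Y → ℝ) (q : J × K) (z : Fin 4 → X × Y) : ℝ :=
  let p : X → Y → ℝ := fun x y => pX q.1 x * pY q.2 y
  p (z 0).1 (z 0).2 * p (z 1).1 (z 1).2 - 2 * (p (z 0).1 (z 0).2 * p (z 1).1 (z 2).2)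
    + p (z 0).1 (z 1).2 * p (z 2).1 (z 3).2

/-- The kernel `h = h^M` of the `U`-statistic, truncated to `M`. -/
def kernel (pX : J → X → ℝ) (pY : K → Y → ℝ) (M : Set (J × K)) (z : Fin 4 → X × Y) : ℝ :=
  ∑' q : M, kernelTerm pX pY q.1 z

open Classical in
/-- `‖h‖_∞ ∈ [0,∞]`. It is `∞` if `M` is infinite and the series that defines `h` fails to
converge (unconditionally) at some point. -/
def kernelSupNorm (pX : J → X → ℝ) (pY : K → Y → ℝ) (M : Set (J × K)) : ℝ≥0∞ :=
  if ∀ z : Fin 4 → X × Y, Summable (fun q : M => kernelTerm pX pY q.1 z)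
  then supNorm (kernel pX pY M) else ∞

end IndepTest

end

/-! For a pair of observations u = ((x₁,y₁),(x₂,y₂)) and an index q = (j,k), the contrast w_q(u) =
(p_j(x₁) - p_j(x₂))(p_k(y₁) - p_k(y₂)) has two properties. Its mean under f is 2(a_jk - a_j• a_•k),
and it changes sign when y₁ and y₂ are exchanged, an operation that preserves the law of the pair
whenever the coordinates are independent. The sample is split into two blocks U, V of m = ⌊n/4⌋
disjoint pairs. With k(u,v) = ∑_{q∈M} w_q(u) w_q(v), g(u) = ∑_l k(u,V_l), T = ∑_i g(U_i) and S = ∑_i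
g(U_i)², the test rejects when S < αT².

Level. Given V, the function g is fixed and odd. The symmetry kills the off-diagonal terms of T²/S,
so E[T²/S] ≤ 1, and Markov's inequality bounds the size by α. Self-normalisation makes this valid
for every null law, without densities or moments (`measureReal_selfNormalized_le`,
`exists_validTest`).

Power. The mean of T is m²κ with κ = 4∑_{q∈M}(a_jk - a_j• a_•k)². Both Var T and E S are controlled
by two quantities: e = E k² and c, the second moment of the projection u ↦ E k(u,·)
(`measureReal_selfNormalized_ge_le`). Since f and its marginals are at most A and the p_jk are
orthonormal, E(∑ c_q w_q)² ≤ 16A² ∑ c_q². This gives c ≤ 16A²κ and e ≤ (16A²)²|M|. Alternatively e ≤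
(16‖h_M‖)², because k is a combination of values of h_M (`featureKernel_contrast_bound`). Hence the
minimum of ‖h_M‖ and |M|^{1/2} in the rate.

Bias. By Parseval the squared coefficients sum to D(f), and the smoothness constraint bounds those
outside M by R² once R ≥ r/inf θ. So κ ≥ 4(ρ² - R²), and at ρ = CR with C² = 2048A²/(αβ) the type II
error is at most β (`typeII_arith`, `minimaxRisk_le`). -/

noncomputable section

namespace IndepTest

/-! ### Splitting the sample into blocks of disjoint pairs. -/

section Sampling

/-- Selecting coordinates along an injection maps a power of `P` to a power of `P`. -/
theorem measurePreserving_comp_injective {Z ι κ : Type*} [MeasurableSpace Z] [Fintype ι] [Fintype κ]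
    (P : Measure Z) [IsProbabilityMeasure P] {e : ι → κ} (he : Function.Injective e) :
    MeasurePreserving (fun (z : κ → Z) i => z (e i)) (Measure.pi fun _ => P)
      (Measure.pi fun _ => P) := by
  have hm : Measurable (fun (z : κ → Z) i => z (e i)) := by fun_prop
  refine ⟨hm, (Measure.pi_eq fun s hs => ?_).symm⟩
  rw [Measure.map_apply hm (MeasurableSet.univ_pi hs)]
  have : (fun (z : κ → Z) i => z (e i)) ⁻¹' (univ.pi s)
      = univ.pi fun k => {x | ∀ i, e i = k → x ∈ s i} := by
    ext z
    simp only [mem_preimage, mem_univ_pi, mem_ofPred_eq]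
    exact ⟨fun h k i hi => hi ▸ h i, fun h i => h (e i) i rfl⟩
  rw [this, Measure.pi_pi]
  symm
  refine Fintype.prod_of_injective e he _ _ ?_ ?_
  · intro k hk
    have : {x | ∀ i, e i = k → x ∈ s i} = univ :=
      eq_univ_of_forall fun x i hi => absurd ⟨i, hi⟩ hk
    rw [this, measure_univ]
  · intro i
    congr 1
    ext x
    simp only [mem_ofPred_eq]
    exact ⟨fun h i' hi' => he hi' ▸ h, fun h => h i rfl⟩

/-- Two blocks of `m` disjoint pairs of observations out of a sample of size `n ≥ 4 m`. -/
theorem exists_pairing {m n : ℕ} (h : 4 * m ≤ n) (Z : Type*) [MeasurableSpace Z] :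
    ∃ Φ : (Fin n → Z) → (Fin m → Z × Z) × (Fin m → Z × Z), Measurable Φ ∧
      ∀ (P : Measure Z) [IsProbabilityMeasure P],
        MeasurePreserving Φ (Measure.pi fun _ => P)
          ((Measure.pi fun _ => P.prod P).prod (Measure.pi fun _ => P.prod P)) := by
  have hc : Fintype.card ((Fin m ⊕ Fin m) ⊕ (Fin m ⊕ Fin m)) ≤ Fintype.card (Fin n) := by
    simp; omega
  obtain ⟨e⟩ := Function.Embedding.nonempty_of_card_le hc
  refine ⟨fun z => (fun i => (z (e (.inl (.inl i))), z (e (.inl (.inr i)))),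
    fun i => (z (e (.inr (.inl i))), z (e (.inr (.inr i))))), by fun_prop, fun P _ => ?_⟩
  have h1 := measurePreserving_comp_injective P e.injective
  have h2 := measurePreserving_sumPiEquivProdPi
    (X := fun _ : (Fin m ⊕ Fin m) ⊕ (Fin m ⊕ Fin m) => Z) (fun _ => P)
  have h3 := measurePreserving_sumPiEquivProdPi (X := fun _ : Fin m ⊕ Fin m => Z) (fun _ => P)
  have h4 := (measurePreserving_arrowProdEquivProdArrow Z Z (Fin m) (fun _ => P)
    (fun _ => P)).symm
  have h5 := h4.comp h3
  exact (h5.prod h5).comp (h2.comp h1)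

end Sampling

/-! ### Level of self-normalised sums of odd functions. -/

section Level

variable {W : Type*} [MeasurableSpace W]

/-- The sign flip in one coordinate kills the off-diagonal terms of a self-normalised square. -/
theorem integral_selfNormalized_offDiag (Q : Measure W) [IsProbabilityMeasure Q] {s : W → W}
    (hs : MeasurePreserving s Q Q) {g : W → ℝ} (hg : Measurable g) (hgs : ∀ u, g (s u) = -g u)
    {m : ℕ} {i l : Fin m} (hil : i ≠ l) :
    ∫ u, g (u i) * g (u l) / ∑ k, g (u k) ^ 2 ∂(Measure.pi fun _ : Fin m => Q) = 0 := by
  classical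
  let σ : (k : Fin m) → W → W := fun k => if k = i then s else id
  have hσ : ∀ k, MeasurePreserving (σ k) Q Q := fun k => by
    by_cases hk : k = i
    · simpa [σ, hk] using hs
    · simpa [σ, hk] using MeasurePreserving.id Q
  have hp := measurePreserving_pi (fun _ : Fin m => Q) (fun _ : Fin m => Q) hσ
  have h1 : ∀ u : Fin m → W, g (σ i (u i)) = -g (u i) := fun u => by simp [σ, hgs]
  have h2 : ∀ u : Fin m → W, g (σ l (u l)) = g (u l) := fun u => by simp [σ, hil.symm]
  have h3 : ∀ (u : Fin m → W) k, g (σ k (u k)) ^ 2 = g (u k) ^ 2 := fun u k => by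
    by_cases hk : k = i
    · simp [σ, hk, hgs]
    · simp [σ, hk]
  have hF : Measurable fun u : Fin m → W => g (u i) * g (u l) / ∑ k, g (u k) ^ 2 := by fun_prop
  have key := integral_map (μ := Measure.pi fun _ : Fin m => Q) hp.measurable.aemeasurable
    hF.aestronglyMeasurable
  rw [hp.map_eq] at key
  simp only [h1, h2, h3, neg_mul, neg_div, integral_neg] at key
  linarith

/-- Only the diagonal of (∑ g)² / ∑ g² survives integration, and it adds up to at most 1; Markov's
inequality at 1/α does the rest. Every term of the expansion is bounded by 1, so `g` need not have
any moments. -/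
theorem measureReal_selfNormalized_le (Q : Measure W) [IsProbabilityMeasure Q] {s : W → W}
    (hs : MeasurePreserving s Q Q) {g : W → ℝ} (hg : Measurable g) (hgs : ∀ u, g (s u) = -g u)
    (m : ℕ) {α : ℝ} (hα : 0 < α) :
    (Measure.pi fun _ : Fin m => Q).real
      {u | ∑ i, g (u i) ^ 2 < α * (∑ i, g (u i)) ^ 2} ≤ α := by
  set μ := Measure.pi fun _ : Fin m => Q
  let S : (Fin m → W) → ℝ := fun u => ∑ i, g (u i) ^ 2
  have hS0 : ∀ u, 0 ≤ S u := fun u => Finset.sum_nonneg fun i _ => sq_nonneg _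
  have hint : ∀ i l, Integrable (fun u => g (u i) * g (u l) / S u) μ := fun i l => by
    refine Integrable.of_bound (C := 1)
      (by simp only [S]; fun_prop : Measurable _).aestronglyMeasurable (ae_of_all _ fun u => ?_)
    have h1 := Finset.single_le_sum (f := fun k => g (u k) ^ 2) (fun k _ => sq_nonneg _)
      (Finset.mem_univ i)
    have h2 := Finset.single_le_sum (f := fun k => g (u k) ^ 2) (fun k _ => sq_nonneg _)
      (Finset.mem_univ l)
    rw [Real.norm_eq_abs, abs_div, abs_of_nonneg (hS0 u)]
    refine div_le_one_of_le₀ ?_ (hS0 u)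
    refine abs_le_of_sq_le_sq ?_ (hS0 u)
    rw [mul_pow, sq (S u)]
    exact mul_le_mul h1 h2 (sq_nonneg _) (hS0 u)
  have hR : ∀ u, (∑ i, g (u i)) ^ 2 / S u = ∑ i, ∑ l, g (u i) * g (u l) / S u := fun u => by
    rw [sq, Finset.sum_mul_sum, Finset.sum_div]
    simp_rw [Finset.sum_div]
  have hRint : Integrable (fun u => (∑ i, g (u i)) ^ 2 / S u) μ := by
    simp_rw [hR]
    exact integrable_finsetSum _ fun i _ => integrable_finsetSum _ fun l _ => hint i l
  have hle : ∫ u, (∑ i, g (u i)) ^ 2 / S u ∂μ ≤ 1 := by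
    have : ∫ u, (∑ i, g (u i)) ^ 2 / S u ∂μ = ∑ i, ∫ u, g (u i) * g (u i) / S u ∂μ := by
      simp_rw [hR]
      rw [integral_finsetSum _ fun i _ => integrable_finsetSum _ fun l _ => hint i l]
      refine Finset.sum_congr rfl fun i _ => ?_
      rw [integral_finsetSum _ fun l _ => hint i l]
      exact Finset.sum_eq_single_of_mem i (Finset.mem_univ i) fun l _ hl =>
        integral_selfNormalized_offDiag Q hs hg hgs hl.symm
    rw [this, ← integral_finsetSum _ fun i _ => hint i i]
    calc _ ≤ ∫ _, (1 : ℝ) ∂μ := by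
          refine integral_mono (integrable_finsetSum _ fun i _ => hint i i)
            (integrable_const _) fun u => ?_
          simp only [← Finset.sum_div, ← sq]
          exact div_self_le_one _
      _ = 1 := by simp
  have hmk := mul_meas_ge_le_integral_of_nonneg (μ := μ)
    (ae_of_all _ fun u => div_nonneg (sq_nonneg _) (hS0 u)) hRint α⁻¹
  have hsub : {u | S u < α * (∑ i, g (u i)) ^ 2} ⊆ {u | α⁻¹ ≤ (∑ i, g (u i)) ^ 2 / S u} := by
    intro u hu
    simp only [mem_ofPred_eq] at hu ⊢
    -- When the normalisation vanishes, so does every summand, and the strict inequality 0 < 0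
    -- fails. The convention 0/0 = 0 thus does no harm.
    rcases (hS0 u).eq_or_lt with h0 | h0
    · exfalso
      have hz : ∀ i, g (u i) = 0 := fun i => by
        have := (Finset.sum_eq_zero_iff_of_nonneg fun k _ => sq_nonneg (g (u k))).1 h0.symm i
          (Finset.mem_univ i)
        simpa using this
      simp [S, hz] at hu
    · rw [le_div_iff₀ h0, inv_mul_le_iff₀ hα]
      exact hu.le
  have h1 : α⁻¹ * μ.real {u | S u < α * (∑ i, g (u i)) ^ 2} ≤ 1 :=
    (mul_le_mul_of_nonneg_left (measureReal_mono hsub) (inv_nonneg.2 hα.le)).trans (hmk.trans hle)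
  rw [inv_mul_le_iff₀ hα, mul_one] at h1
  exact h1

end Level

/-! ### Type II error of the self-normalised test from second moments. -/

section Power

variable {W : Type*} [MeasurableSpace W]

theorem sq_integral_le {Q : Measure W} [IsProbabilityMeasure Q] {g : W → ℝ} (hg : MemLp g 2 Q) :
    (∫ u, g u ∂Q) ^ 2 ≤ ∫ u, g u ^ 2 ∂Q := by
  have h := variance_nonneg g Q
  rw [variance_eq_sub hg] at h
  simp only [Pi.pow_apply] at h
  linarith

theorem memLp_sum_pi (Q : Measure W) [IsProbabilityMeasure Q] {g : W → ℝ}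
    (hg : MemLp g 2 Q) (m : ℕ) :
    MemLp (fun u : Fin m → W => ∑ i, g (u i)) 2 (Measure.pi fun _ => Q) :=
  memLp_finsetSum _ fun i _ =>
    hg.comp_measurePreserving (measurePreserving_eval (fun _ : Fin m => Q) i)

theorem integral_eval_pi (Q : Measure W) [IsProbabilityMeasure Q] {g : W → ℝ}
    (hg : AEStronglyMeasurable g Q) {m : ℕ} (i : Fin m) :
    ∫ u, g (u i) ∂(Measure.pi fun _ : Fin m => Q) = ∫ u, g u ∂Q := by
  have hp := measurePreserving_eval (fun _ : Fin m => Q) i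
  have := integral_map (f := g) hp.measurable.aemeasurable (by rwa [hp.map_eq])
  rw [hp.map_eq] at this
  exact this.symm

theorem integral_sum_pi (Q : Measure W) [IsProbabilityMeasure Q] {g : W → ℝ}
    (hg : Integrable g Q) (m : ℕ) :
    ∫ u, (∑ i, g (u i)) ∂(Measure.pi fun _ : Fin m => Q) = m * ∫ u, g u ∂Q := by
  have hi : ∀ i, Integrable (fun u : Fin m → W => g (u i)) (Measure.pi fun _ : Fin m => Q) :=
    fun i => (measurePreserving_eval (fun _ : Fin m => Q) i).integrable_comp_of_integrable hg
  rw [integral_finsetSum _ fun i _ => hi i]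
  simp_rw [integral_eval_pi Q hg.aestronglyMeasurable]
  simp

/-- Second moment of a sum of independent identically distributed variables. -/
theorem integral_sq_sum_pi_le (Q : Measure W) [IsProbabilityMeasure Q] {g : W → ℝ}
    (hg : MemLp g 2 Q) (m : ℕ) :
    ∫ u, (∑ i, g (u i)) ^ 2 ∂(Measure.pi fun _ : Fin m => Q)
      ≤ m * ∫ u, g u ^ 2 ∂Q + m ^ 2 * (∫ u, g u ∂Q) ^ 2 := by
  have h := variance_sum_pi (μ := fun _ : Fin m => Q) (X := fun _ => g) fun _ => hg
  have he : (∑ i, fun u : Fin m → W => g (u i)) = fun u => ∑ i, g (u i) := by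
    ext u; simp
  rw [he, variance_eq_sub (memLp_sum_pi Q hg m), variance_eq_sub hg,
    integral_sum_pi Q (hg.integrable one_le_two) m] at h
  simp only [Pi.pow_apply, Finset.sum_const, Finset.card_univ, Fintype.card_fin,
    nsmul_eq_mul] at h
  have : 0 ≤ (m : ℝ) * (∫ u, g u ∂Q) ^ 2 := by positivity
  nlinarith

variable (Q : Measure W) [IsProbabilityMeasure Q] {k : W → W → ℝ}

theorem memLp_integral_right (hk : MemLp (Function.uncurry k) 2 (Q.prod Q))
    (hks : ∀ u, MemLp (k u) 2 Q) : MemLp (fun u => ∫ v, k u v ∂Q) 2 Q := by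
  have hm : AEStronglyMeasurable (fun u => ∫ v, k u v ∂Q) Q :=
    hk.aestronglyMeasurable.integral_prod_right'
  rw [memLp_two_iff_integrable_sq hm]
  have h2 : Integrable (fun p : W × W => k p.1 p.2 ^ 2) (Q.prod Q) := hk.integrable_sq
  refine h2.integral_prod_left.mono' (hm.pow 2) (ae_of_all _ fun u => ?_)
  rw [Real.norm_of_nonneg (sq_nonneg _)]
  exact sq_integral_le (hks u)

/-- Type II error of the self-normalised test based on the kernel `k`, in terms of the mean,
the second moment and the second moment of the projection of `k`. -/
theorem measureReal_selfNormalized_ge_le (hk : MemLp (Function.uncurry k) 2 (Q.prod Q))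
    (hks : ∀ u, MemLp (k u) 2 Q) (hsymm : ∀ u v, k u v = k v u) {m : ℕ} (hm : 0 < m)
    {α κ : ℝ} (hα : 0 < α) (hα1 : α ≤ 1) (hκ : ∫ p, k p.1 p.2 ∂(Q.prod Q) = κ) (hκ0 : 0 < κ) :
    ((Measure.pi fun _ : Fin m => Q).prod (Measure.pi fun _ : Fin m => Q)).real
      {p | α * (∑ i, ∑ l, k (p.1 i) (p.2 l)) ^ 2 ≤ ∑ i, (∑ l, k (p.1 i) (p.2 l)) ^ 2}
      ≤ 8 / α * ((∫ p, k p.1 p.2 ^ 2 ∂(Q.prod Q)) / (m ^ 2 * κ ^ 2)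
        + 2 * (∫ u, (∫ v, k u v ∂Q) ^ 2 ∂Q) / (m * κ ^ 2)) := by
  set e := ∫ p, k p.1 p.2 ^ 2 ∂(Q.prod Q) with he
  set c := ∫ u, (∫ v, k u v ∂Q) ^ 2 ∂Q with hc
  set μ := Measure.pi fun _ : Fin m => Q with hμ
  have hm0 : (0 : ℝ) < m := by exact_mod_cast hm
  have hmk := memLp_integral_right Q hk hks
  have hk1 : Integrable (Function.uncurry k) (Q.prod Q) := hk.integrable one_le_two
  have hksq : Integrable (fun p : W × W => k p.1 p.2 ^ 2) (Q.prod Q) := hk.integrable_sq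
  have hκ' : ∫ u, ∫ v, k u v ∂Q ∂Q = κ := by rw [← hκ]; exact (integral_prod _ hk1).symm
  have hev : ∀ i l, MeasurePreserving (fun p : (Fin m → W) × (Fin m → W) => (p.1 i, p.2 l))
      (μ.prod μ) (Q.prod Q) := fun i l =>
    (measurePreserving_eval (fun _ : Fin m => Q) i).prod
      (measurePreserving_eval (fun _ : Fin m => Q) l)
  have hkil : ∀ i l, MemLp (fun p : (Fin m → W) × (Fin m → W) => k (p.1 i) (p.2 l)) 2
      (μ.prod μ) := fun i l => hk.comp_measurePreserving (hev i l)
  have hG : ∀ i, MemLp (fun p : (Fin m → W) × (Fin m → W) => ∑ l, k (p.1 i) (p.2 l)) 2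
      (μ.prod μ) := fun i => memLp_finsetSum _ fun l _ => hkil i l
  have hT : MemLp (fun p : (Fin m → W) × (Fin m → W) => ∑ i, ∑ l, k (p.1 i) (p.2 l)) 2
      (μ.prod μ) := memLp_finsetSum _ fun i _ => hG i
  -- the normalisation
  have hG' : MemLp (fun p : W × (Fin m → W) => ∑ l, k p.1 (p.2 l)) 2 (Q.prod μ) :=
    memLp_finsetSum _ fun l _ => hk.comp_measurePreserving
      ((MeasurePreserving.id Q).prod (measurePreserving_eval (fun _ : Fin m => Q) l))
  have hVi : ∀ i, ∫ p, (∑ l, k (p.1 i) (p.2 l)) ^ 2 ∂(μ.prod μ)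
      = ∫ p, (∑ l, k p.1 (p.2 l)) ^ 2 ∂(Q.prod μ) := fun i => by
    have hp : MeasurePreserving (fun p : (Fin m → W) × (Fin m → W) => (p.1 i, p.2))
        (μ.prod μ) (Q.prod μ) :=
      (measurePreserving_eval (fun _ : Fin m => Q) i).prod (MeasurePreserving.id μ)
    have := integral_map (μ := μ.prod μ) (f := fun p : W × (Fin m → W) => (∑ l, k p.1 (p.2 l)) ^ 2)
      hp.measurable.aemeasurable
      (by rw [hp.map_eq]; exact hG'.aestronglyMeasurable.pow 2)
    rw [hp.map_eq] at this
    exact this.symm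
  -- For a fixed first argument the inner sum consists of `m` independent terms, whose mean is the
  -- projection of `k`.
  have hGm : ∫ p, (∑ l, k p.1 (p.2 l)) ^ 2 ∂(Q.prod μ) ≤ m * e + m ^ 2 * c := by
    rw [integral_prod _ hG'.integrable_sq]
    have hi1 : Integrable (fun u => ∫ v, k u v ^ 2 ∂Q) Q := hksq.integral_prod_left
    calc _ ≤ ∫ u, (m * ∫ v, k u v ^ 2 ∂Q + m ^ 2 * (∫ v, k u v ∂Q) ^ 2) ∂Q :=
          integral_mono hG'.integrable_sq.integral_prod_left
            ((hi1.const_mul _).add (hmk.integrable_sq.const_mul _))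
            fun u => integral_sq_sum_pi_le Q (hks u) m
      _ = m * e + m ^ 2 * c := by
          rw [integral_add (hi1.const_mul _) (hmk.integrable_sq.const_mul _),
            integral_const_mul, integral_const_mul, he, integral_prod _ hksq]
  set v := ∫ p, (∑ l, k p.1 (p.2 l)) ^ 2 ∂(Q.prod μ) with hv
  have hV : ∫ p, (∑ i, (∑ l, k (p.1 i) (p.2 l)) ^ 2) ∂(μ.prod μ) = m * v := by
    rw [integral_finsetSum _ fun i _ => (hG i).integrable_sq]
    simp_rw [hVi]
    simp [hv]
  -- the statistic
  have hTm : ∫ p, (∑ i, ∑ l, k (p.1 i) (p.2 l)) ∂(μ.prod μ) = m ^ 2 * κ := by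
    rw [integral_finsetSum _ fun i _ => (hG i).integrable one_le_two]
    have : ∀ i, ∫ p, (∑ l, k (p.1 i) (p.2 l)) ∂(μ.prod μ) = m * κ := fun i => by
      rw [integral_finsetSum _ fun l _ => (hkil i l).integrable one_le_two]
      have : ∀ l, ∫ p, k (p.1 i) (p.2 l) ∂(μ.prod μ) = κ := fun l => by
        have h := integral_map (μ := μ.prod μ) (f := Function.uncurry k)
          (hev i l).measurable.aemeasurable
          (by rw [(hev i l).map_eq]; exact hk.aestronglyMeasurable)
        rw [(hev i l).map_eq] at h
        rw [← hκ]
        exact h.symm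
      simp [this]
    simp only [this, Finset.sum_const, Finset.card_univ, Fintype.card_fin, nsmul_eq_mul]
    ring
  have hswap : ∀ V : Fin m → W, MemLp (fun u => ∑ l, k u (V l)) 2 Q := fun V =>
    memLp_finsetSum _ fun l _ => by
      have := hks (V l)
      refine this.congr_norm ?_ ?_
      · have h2 : (fun u => k u (V l)) = k (V l) := funext fun u => hsymm _ _
        rw [h2]; exact this.aestronglyMeasurable
      · exact ae_of_all _ fun u => by rw [hsymm]
  -- Given the second block, the statistic is a sum of `m` i.i.d. terms. By symmetry of `k` their
  -- conditional mean is itself an i.i.d. sum of projections, so the second-moment bound applies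
  -- twice.
  have hTsq : ∫ p, (∑ i, ∑ l, k (p.1 i) (p.2 l)) ^ 2 ∂(μ.prod μ)
      ≤ m * v + m ^ 2 * (m * c + m ^ 2 * κ ^ 2) := by
    rw [integral_prod_symm _ hT.integrable_sq]
    have hin : ∀ V : Fin m → W, ∫ u, (∑ l, k u (V l)) ∂Q = ∑ l, ∫ w, k (V l) w ∂Q := fun V => by
      have : ∀ u, ∑ l, k u (V l) = ∑ l, k (V l) u := fun u =>
        Finset.sum_congr rfl fun l _ => hsymm _ _
      simp_rw [this]
      exact integral_finsetSum _ fun l _ => (hks (V l)).integrable one_le_two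
    have hi1 : Integrable (fun V : Fin m → W => ∫ u, (∑ l, k u (V l)) ^ 2 ∂Q) μ :=
      hG'.integrable_sq.integral_prod_right
    have hi2 : Integrable (fun V : Fin m → W => (∑ l, ∫ w, k (V l) w ∂Q) ^ 2) μ :=
      (memLp_sum_pi Q hmk m).integrable_sq
    calc _ ≤ ∫ V, (m * ∫ u, (∑ l, k u (V l)) ^ 2 ∂Q
            + m ^ 2 * (∑ l, ∫ w, k (V l) w ∂Q) ^ 2) ∂μ := by
          refine integral_mono hT.integrable_sq.integral_prod_right
            ((hi1.const_mul _).add (hi2.const_mul _)) fun V => ?_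
          have := integral_sq_sum_pi_le Q (hswap V) m
          rwa [hin] at this
      _ = m * v + m ^ 2 * ∫ V, (∑ l, ∫ w, k (V l) w ∂Q) ^ 2 ∂μ := by
          rw [integral_add (hi1.const_mul _) (hi2.const_mul _), integral_const_mul,
            integral_const_mul, hv, integral_prod_symm _ hG'.integrable_sq]
      _ ≤ _ := by
          have := integral_sq_sum_pi_le Q hmk m
          rw [hκ'] at this
          gcongr
  -- Markov's inequality
  set τ : ℝ := m ^ 2 * κ with hτ
  have hτ0 : 0 < τ := by positivity
  set T : (Fin m → W) × (Fin m → W) → ℝ := fun p => ∑ i, ∑ l, k (p.1 i) (p.2 l) with hTdef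
  set V : (Fin m → W) × (Fin m → W) → ℝ := fun p => ∑ i, (∑ l, k (p.1 i) (p.2 l)) ^ 2 with hVdef
  have hV0 : ∀ p, 0 ≤ V p := fun p => Finset.sum_nonneg fun i _ => sq_nonneg _
  have hVint : Integrable V (μ.prod μ) := integrable_finsetSum _ fun i _ => (hG i).integrable_sq
  have hTint : Integrable T (μ.prod μ) := hT.integrable one_le_two
  have hT2int : Integrable (fun p => T p ^ 2) (μ.prod μ) := hT.integrable_sq
  -- Chebyshev for `T` and Markov for `V` in a single function: acceptance forces either `T` to be
  -- far from its mean `τ` or `V` to be of order `α τ²`, so `H ≥ 1` on that event.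
  let H : (Fin m → W) × (Fin m → W) → ℝ := fun p =>
    4 / τ ^ 2 * (T p ^ 2 - 2 * τ * T p + τ ^ 2) + 4 / (α * τ ^ 2) * V p
  have hi3 : Integrable (fun p => T p ^ 2 - 2 * τ * T p) (μ.prod μ) :=
    hT2int.sub (hTint.const_mul _)
  have hi4 : Integrable (fun p => T p ^ 2 - 2 * τ * T p + τ ^ 2) (μ.prod μ) :=
    hi3.add (integrable_const _)
  have hHint : Integrable H (μ.prod μ) := (hi4.const_mul _).add (hVint.const_mul _)
  have hH0 : ∀ p, 0 ≤ H p := fun p => by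
    have h1 : T p ^ 2 - 2 * τ * T p + τ ^ 2 = (T p - τ) ^ 2 := by ring
    simp only [H, h1]
    have := hV0 p
    positivity
  have hHI : ∫ p, H p ∂(μ.prod μ) ≤ 8 / α * (e / (m ^ 2 * κ ^ 2) + 2 * c / (m * κ ^ 2)) := by
    have h1 : ∫ p, H p ∂(μ.prod μ) = 4 / τ ^ 2 * ((∫ p, T p ^ 2 ∂(μ.prod μ)) - 2 * τ * τ + τ ^ 2)
        + 4 / (α * τ ^ 2) * (m * v) := by
      simp only [H]
      rw [integral_add (hi4.const_mul _) (hVint.const_mul _), integral_const_mul,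
        integral_const_mul, integral_add hi3 (integrable_const _),
        integral_sub hT2int (hTint.const_mul _), integral_const_mul, hTm, hV]
      simp
    have hc0 : 0 ≤ c := integral_nonneg fun u => sq_nonneg _
    have hv0 : 0 ≤ v := integral_nonneg fun u => sq_nonneg _
    have h2 : (∫ p, T p ^ 2 ∂(μ.prod μ)) - 2 * τ * τ + τ ^ 2 ≤ m * v + m ^ 3 * c := by
      rw [hτ]; nlinarith [hTsq]
    have h3 : (m : ℝ) * v + m ^ 3 * c ≤ m ^ 2 * e + 2 * m ^ 3 * c := by nlinarith
    have h4 : (m : ℝ) * v ≤ m ^ 2 * e + 2 * m ^ 3 * c := by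
      have : 0 ≤ (m : ℝ) ^ 3 * c := by positivity
      nlinarith
    have h40 : (0 : ℝ) ≤ m ^ 2 * e + 2 * m ^ 3 * c := le_trans (by positivity) h4
    have h5 : 4 / τ ^ 2 ≤ 4 / (α * τ ^ 2) := by
      apply div_le_div_of_nonneg_left (by norm_num) (by positivity)
      nlinarith [sq_nonneg τ]
    rw [h1]
    calc _ ≤ 4 / τ ^ 2 * (m ^ 2 * e + 2 * m ^ 3 * c)
          + 4 / (α * τ ^ 2) * (m ^ 2 * e + 2 * m ^ 3 * c) := by
          exact add_le_add (mul_le_mul_of_nonneg_left (h2.trans h3) (by positivity))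
            (mul_le_mul_of_nonneg_left h4 (by positivity))
      _ ≤ 4 / (α * τ ^ 2) * (m ^ 2 * e + 2 * m ^ 3 * c)
          + 4 / (α * τ ^ 2) * (m ^ 2 * e + 2 * m ^ 3 * c) := by gcongr
      _ = _ := by
          rw [hτ]
          field_simp
          ring
  refine le_trans ?_ hHI
  have hmk1 := mul_meas_ge_le_integral_of_nonneg (ae_of_all _ hH0) hHint 1
  rw [one_mul] at hmk1
  refine (measureReal_mono ?_).trans hmk1
  intro p hp
  simp only [mem_ofPred_eq] at hp ⊢
  have h1 : T p ^ 2 - 2 * τ * T p + τ ^ 2 = (T p - τ) ^ 2 := by ring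
  have hp' : α * T p ^ 2 ≤ V p := hp
  simp only [H, h1]
  have hfac : 4 / τ ^ 2 * (T p - τ) ^ 2 + 4 / (α * τ ^ 2) * V p
      = (4 * (α * (T p - τ) ^ 2 + V p)) / (α * τ ^ 2) := by field_simp
  rw [hfac, le_div_iff₀ (by positivity)]
  nlinarith [mul_nonneg hα.le (sq_nonneg (2 * T p - τ))]

end Power

/-! ### Moments of kernels built from a Bessel system of features. -/

section FeatureKernel

variable {W ι : Type*}

/-- The kernel `k(u, v) = ∑_q w_q(u) w_q(v)` of a family of features. -/
def featureKernel (w : ι → W → ℝ) (u v : W) : ℝ := ∑' q, w q u * w q v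

theorem featureKernel_symm (w : ι → W → ℝ) (u v : W) :
    featureKernel w u v = featureKernel w v u :=
  tsum_congr fun _ => mul_comm _ _

variable [MeasurableSpace W]

theorem measurable_featureKernel [Countable ι] {w : ι → W → ℝ} (hw : ∀ q, Measurable (w q))
    (hs : ∀ u v, Summable fun q => w q u * w q v) :
    Measurable (Function.uncurry (featureKernel w)) := by
  refine measurable_of_tendsto_metrizable' (u := Filter.atTop)
    (f := fun (N : Finset ι) (p : W × W) => ∑ q ∈ N, w q p.1 * w q p.2) (fun N => ?_) ?_
  · fun_prop
  · rw [tendsto_pi_nhds]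
    exact fun p => (hs p.1 p.2).hasSum

variable (Q : Measure W) {w : ι → W → ℝ} {L : ℝ}

theorem memLp_featureSum (hw : ∀ q, MemLp (w q) 2 Q) (N : Finset ι) :
    MemLp (fun p : W × W => ∑ q ∈ N, w q p.1 * w q p.2) 2 (Q.prod Q) := by
  refine memLp_finsetSum _ fun q _ => ?_
  have hm : AEStronglyMeasurable (fun p : W × W => w q p.1 * w q p.2) (Q.prod Q) :=
    (hw q).aestronglyMeasurable.comp_fst.mul (hw q).aestronglyMeasurable.comp_snd
  rw [memLp_two_iff_integrable_sq hm]
  simp_rw [mul_pow]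
  exact (hw q).integrable_sq.mul_prod (hw q).integrable_sq

/-- Duality: with c_q' = E w_q w_q' the sum s equals E[w_q ∑ c_q' w_q'], and by the
arithmetic-geometric mean inequality this is at most L²/2 + s/2. -/
theorem sum_sq_integral_mul_le (hw : ∀ q, MemLp (w q) 2 Q) (hL0 : 0 < L)
    (hL : ∀ (N : Finset ι) (c : ι → ℝ),
      ∫ u, (∑ q ∈ N, c q * w q u) ^ 2 ∂Q ≤ L * ∑ q ∈ N, c q ^ 2) (N : Finset ι) (q : ι) :
    ∑ q' ∈ N, (∫ u, w q u * w q' u ∂Q) ^ 2 ≤ L ^ 2 := by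
  set c : ι → ℝ := fun q' => ∫ u, w q u * w q' u ∂Q with hc
  set s := ∑ q' ∈ N, c q' ^ 2 with hs
  have hG : MemLp (fun u => ∑ q' ∈ N, c q' * w q' u) 2 Q :=
    memLp_finsetSum _ fun q' _ => (hw q').const_mul _
  have h1 : s = ∫ u, w q u * ∑ q' ∈ N, c q' * w q' u ∂Q := by
    simp_rw [Finset.mul_sum]
    rw [integral_finsetSum]
    · refine Finset.sum_congr rfl fun q' _ => ?_
      simp_rw [mul_left_comm _ (c q')]
      rw [integral_const_mul, sq]
    · intro q' _
      exact (hw q).integrable_mul ((hw q').const_mul _)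
  have h2 : s ≤ ∫ u, (L / 2 * w q u ^ 2 + 1 / (2 * L) * (∑ q' ∈ N, c q' * w q' u) ^ 2) ∂Q := by
    rw [h1]
    refine integral_mono ((hw q).integrable_mul hG)
      (((hw q).integrable_sq.const_mul _).add (hG.integrable_sq.const_mul _)) fun u => ?_
    have := sq_nonneg (L * w q u - ∑ q' ∈ N, c q' * w q' u)
    have h3 : L / 2 * w q u ^ 2 + 1 / (2 * L) * (∑ q' ∈ N, c q' * w q' u) ^ 2
        - w q u * ∑ q' ∈ N, c q' * w q' u
        = (L * w q u - ∑ q' ∈ N, c q' * w q' u) ^ 2 / (2 * L) := by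
      field_simp; ring
    have h4 : 0 ≤ (L * w q u - ∑ q' ∈ N, c q' * w q' u) ^ 2 / (2 * L) := by positivity
    show w q u * _ ≤ _
    linarith
  rw [integral_add ((hw q).integrable_sq.const_mul _) (hG.integrable_sq.const_mul _),
    integral_const_mul, integral_const_mul] at h2
  have h5 : ∫ u, w q u ^ 2 ∂Q ≤ L := by simpa using hL {q} 1
  have h6 := hL N c
  have h7 : 1 / (2 * L) * ∫ u, (∑ q' ∈ N, c q' * w q' u) ^ 2 ∂Q ≤ s / 2 := by
    rw [one_div, inv_mul_le_iff₀ (by positivity)]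
    linarith
  nlinarith

variable [IsProbabilityMeasure Q]

theorem integral_featureSum (hw : ∀ q, MemLp (w q) 2 Q) (N : Finset ι) :
    ∫ p, (∑ q ∈ N, w q p.1 * w q p.2) ∂(Q.prod Q) = ∑ q ∈ N, (∫ u, w q u ∂Q) ^ 2 := by
  rw [integral_finsetSum]
  · exact Finset.sum_congr rfl fun q _ => by rw [integral_prod_mul (w q) (w q), sq]
  · exact fun q _ => ((hw q).integrable one_le_two).mul_prod ((hw q).integrable one_le_two)

theorem integral_featureSum_right (hw : ∀ q, MemLp (w q) 2 Q) (N : Finset ι) (u : W) :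
    ∫ v, (∑ q ∈ N, w q u * w q v) ∂Q = ∑ q ∈ N, (∫ v, w q v ∂Q) * w q u := by
  rw [integral_finsetSum _ fun q _ => ((hw q).integrable one_le_two).const_mul _]
  exact Finset.sum_congr rfl fun q _ => by rw [integral_const_mul, mul_comm]

/-- The integral is the squared Hilbert–Schmidt norm of the Gram matrix (E w_q w_q'), each of whose
rows has squared norm at most L². -/
theorem integral_sq_featureSum_le (hw : ∀ q, MemLp (w q) 2 Q) (hL0 : 0 < L)
    (hL : ∀ (N : Finset ι) (c : ι → ℝ),
      ∫ u, (∑ q ∈ N, c q * w q u) ^ 2 ∂Q ≤ L * ∑ q ∈ N, c q ^ 2) (N : Finset ι) :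
    ∫ p, (∑ q ∈ N, w q p.1 * w q p.2) ^ 2 ∂(Q.prod Q) ≤ L ^ 2 * N.card := by
  have hi : ∀ q q', Integrable (fun u => w q u * w q' u) Q := fun q q' =>
    (hw q).integrable_mul (hw q')
  have h1 : ∀ p : W × W, (∑ q ∈ N, w q p.1 * w q p.2) ^ 2
      = ∑ q ∈ N, ∑ q' ∈ N, (w q p.1 * w q' p.1) * (w q p.2 * w q' p.2) := fun p => by
    rw [sq, Finset.sum_mul_sum]
    exact Finset.sum_congr rfl fun q _ => Finset.sum_congr rfl fun q' _ => by ring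
  have hi2 : ∀ q q', Integrable (fun p : W × W =>
      (w q p.1 * w q' p.1) * (w q p.2 * w q' p.2)) (Q.prod Q) := fun q q' =>
    (hi q q').mul_prod (hi q q')
  simp_rw [h1]
  rw [integral_finsetSum _ fun q _ => integrable_finsetSum _ fun q' _ => hi2 q q']
  calc _ ≤ ∑ q ∈ N, L ^ 2 := by
        refine Finset.sum_le_sum fun q _ => ?_
        rw [integral_finsetSum _ fun q' _ => hi2 q q']
        refine le_trans (le_of_eq ?_) (sum_sq_integral_mul_le Q hw hL0 hL N q)
        refine Finset.sum_congr rfl fun q' _ => ?_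
        rw [integral_prod_mul (fun u => w q u * w q' u) (fun u => w q u * w q' u), sq]
    _ = L ^ 2 * N.card := by simp [mul_comm]

/-- The properties of a feature kernel that control the power of the test. -/
structure KernelBounds (Q : Measure W) (k : W → W → ℝ) (κ L e : ℝ) : Prop where
  memLp : MemLp (Function.uncurry k) 2 (Q.prod Q)
  memLp_right : ∀ u, MemLp (k u) 2 Q
  integral_eq : ∫ p, k p.1 p.2 ∂(Q.prod Q) = κ
  projection_le : ∫ u, (∫ v, k u v ∂Q) ^ 2 ∂Q ≤ L * κ
  sq_le : ∫ p, k p.1 p.2 ^ 2 ∂(Q.prod Q) ≤ e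

/-- The projection of the kernel is ∑ b_q w_q with b_q = E w_q, and κ = ∑ b_q². The hypothesis on L
with coefficients b is therefore exactly the projection bound. -/
theorem kernelBounds_of_fintype [Fintype ι] (hw : ∀ q, MemLp (w q) 2 Q) (hL0 : 0 < L)
    (hL : ∀ (N : Finset ι) (c : ι → ℝ),
      ∫ u, (∑ q ∈ N, c q * w q u) ^ 2 ∂Q ≤ L * ∑ q ∈ N, c q ^ 2) :
    KernelBounds Q (featureKernel w) (∑' q, (∫ u, w q u ∂Q) ^ 2) L (L ^ 2 * Fintype.card ι) := by
  have hk : featureKernel w = fun u v => ∑ q, w q u * w q v := by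
    ext u v; exact tsum_fintype _
  rw [hk, tsum_fintype]
  refine ⟨memLp_featureSum Q hw _, fun u => memLp_finsetSum _ fun q _ => (hw q).const_mul _,
    integral_featureSum Q hw _, ?_, integral_sq_featureSum_le Q hw hL0 hL _⟩
  simp_rw [integral_featureSum_right Q hw]
  exact hL _ _

/-- By Cauchy–Schwarz, a bound B on the diagonal bounds all finite partial sums of the kernel
everywhere. Dominated convergence then carries the finite identities and the projection bound over
to infinite index sets. -/
theorem kernelBounds_of_bounded [Countable ι] (hm : ∀ q, Measurable (w q))
    (hw : ∀ q, MemLp (w q) 2 Q)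
    (hL : ∀ (N : Finset ι) (c : ι → ℝ),
      ∫ u, (∑ q ∈ N, c q * w q u) ^ 2 ∂Q ≤ L * ∑ q ∈ N, c q ^ 2) {B : ℝ}
    (hs : ∀ u, Summable fun q => w q u ^ 2) (hB : ∀ u, ∑' q, w q u ^ 2 ≤ B)
    (hb : Summable fun q => (∫ u, w q u ∂Q) ^ 2) :
    KernelBounds Q (featureKernel w) (∑' q, (∫ u, w q u ∂Q) ^ 2) L (B ^ 2) := by
  have habs : ∀ u v, Summable fun q => |w q u * w q v| := fun u v => by
    refine Summable.of_nonneg_of_le (fun q => abs_nonneg _) (fun q => ?_) ((hs u).add (hs v))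
    rw [abs_le]
    constructor <;> nlinarith [sq_nonneg (w q u + w q v), sq_nonneg (w q u - w q v),
      sq_nonneg (w q u), sq_nonneg (w q v)]
  have hsum : ∀ u v, Summable fun q => w q u * w q v := fun u v => (habs u v).of_abs
  have hN : ∀ (N : Finset ι) u v, |∑ q ∈ N, w q u * w q v| ≤ B := fun N u v => by
    have h1 : ∀ u, ∑ q ∈ N, w q u ^ 2 ≤ B := fun u =>
      ((hs u).sum_le_tsum N fun _ _ => sq_nonneg _).trans (hB u)
    have hB0 : 0 ≤ B := (Finset.sum_nonneg fun q _ => sq_nonneg (w q u)).trans (h1 u)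
    refine abs_le_of_sq_le_sq ?_ hB0
    calc _ ≤ (∑ q ∈ N, w q u ^ 2) * ∑ q ∈ N, w q v ^ 2 := Finset.sum_mul_sq_le_sq_mul_sq _ _ _
      _ ≤ B * B := mul_le_mul (h1 u) (h1 v) (Finset.sum_nonneg fun q _ => sq_nonneg _) hB0
      _ = B ^ 2 := (sq B).symm
  have hlim : ∀ u v, Filter.Tendsto (fun N : Finset ι => ∑ q ∈ N, w q u * w q v) Filter.atTop
      (nhds (featureKernel w u v)) := fun u v => (hsum u v).hasSum
  have hkB : ∀ u v, |featureKernel w u v| ≤ B := fun u v =>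
    le_of_tendsto (hlim u v).abs (Filter.Eventually.of_forall fun N => hN N u v)
  have hkm := measurable_featureKernel hm hsum
  have hmem : MemLp (Function.uncurry (featureKernel w)) 2 (Q.prod Q) :=
    MemLp.of_bound hkm.aestronglyMeasurable B (ae_of_all _ fun p => hkB p.1 p.2)
  have hproj : ∀ u, Filter.Tendsto (fun N : Finset ι => ∑ q ∈ N, (∫ v, w q v ∂Q) * w q u)
      Filter.atTop (nhds (∫ v, featureKernel w u v ∂Q)) := fun u => by
    simp_rw [← integral_featureSum_right Q hw]
    refine tendsto_integral_filter_of_dominated_convergence (fun _ => B)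
      (Filter.Eventually.of_forall fun N => ?_)
      (Filter.Eventually.of_forall fun N => ae_of_all _ fun v => hN N u v)
      (integrable_const _) (ae_of_all _ fun v => hlim u v)
    exact (by fun_prop : Measurable fun v => ∑ q ∈ N, w q u * w q v).aestronglyMeasurable
  refine ⟨hmem, fun u => ?_, ?_, ?_, ?_⟩
  · exact MemLp.of_bound (hkm.comp measurable_prodMk_left).aestronglyMeasurable B
      (ae_of_all _ fun v => hkB u v)
  · refine tendsto_nhds_unique ?_ hb.hasSum
    simp_rw [← integral_featureSum Q hw]
    refine tendsto_integral_filter_of_dominated_convergence (fun _ => B)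
      (Filter.Eventually.of_forall fun N => (memLp_featureSum Q hw N).aestronglyMeasurable)
      (Filter.Eventually.of_forall fun N => ae_of_all _ fun p => hN N p.1 p.2)
      (integrable_const _) (ae_of_all _ fun p => hlim p.1 p.2)
  · have h1 : Filter.Tendsto
        (fun N : Finset ι => ∫ u, (∑ q ∈ N, (∫ v, w q v ∂Q) * w q u) ^ 2 ∂Q)
        Filter.atTop (nhds (∫ u, (∫ v, featureKernel w u v ∂Q) ^ 2 ∂Q)) := by
      refine tendsto_integral_filter_of_dominated_convergence (fun _ => B ^ 2)
        (Filter.Eventually.of_forall fun N => ?_)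
        (Filter.Eventually.of_forall fun N => ae_of_all _ fun u => ?_)
        (integrable_const _) (ae_of_all _ fun u => (hproj u).pow 2)
      · exact (by fun_prop : Measurable fun u =>
          (∑ q ∈ N, (∫ v, w q v ∂Q) * w q u) ^ 2).aestronglyMeasurable
      · rw [Real.norm_of_nonneg (sq_nonneg _), ← integral_featureSum_right Q hw]
        refine sq_le_sq' ?_ ?_ <;>
        have h := norm_integral_le_of_norm_le_const (μ := Q) (C := B)
          (f := fun v => ∑ q ∈ N, w q u * w q v) (ae_of_all _ fun v => hN N u v) <;>
        simp only [probReal_univ, mul_one, Real.norm_eq_abs] at h <;>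
        have := abs_le.1 h <;> linarith
    exact le_of_tendsto_of_tendsto h1 (hb.hasSum.const_mul L)
      (Filter.Eventually.of_forall fun N => hL N _)
  · have h1 : ∀ p : W × W, featureKernel w p.1 p.2 ^ 2 ≤ B ^ 2 := fun p =>
      sq_le_sq' (abs_le.1 (hkB _ _)).1 (abs_le.1 (hkB _ _)).2
    calc _ ≤ ∫ _, B ^ 2 ∂(Q.prod Q) := integral_mono hmem.integrable_sq (integrable_const _) h1
      _ = B ^ 2 := by simp

end FeatureKernel

/-! ### Orthonormal bases of L² in terms of integrals. -/

section Basis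

variable {Z ι : Type*} [MeasurableSpace Z] {ν : Measure Z} {p : ι → Z → ℝ}

theorem inner_toLp_eq_integral {g h : Z → ℝ} (hg : MemLp g 2 ν) (hh : MemLp h 2 ν) :
    inner ℝ (hg.toLp g) (hh.toLp h) = ∫ z, g z * h z ∂ν := by
  rw [L2.inner_def]
  refine integral_congr_ae ?_
  filter_upwards [hg.coeFn_toLp, hh.coeFn_toLp] with z h1 h2
  rw [h1, h2]
  simp [mul_comm]

open Classical in
theorem IsL2Basis.integral_mul (hp : IsL2Basis ν p) (i l : ι) :
    ∫ z, p i z * p l z ∂ν = if i = l then 1 else 0 := by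
  rw [← inner_toLp_eq_integral (hp.memLp i) (hp.memLp l)]
  exact orthonormal_iff_ite.1 hp.orthonormal i l

theorem IsL2Basis.tsum_sq_integral (hp : IsL2Basis ν p) {g : Z → ℝ} (hg : MemLp g 2 ν) :
    ∑' i, ENNReal.ofReal ((∫ z, g z * p i z ∂ν) ^ 2) = ENNReal.ofReal (∫ z, g z ^ 2 ∂ν) := by
  let b := HilbertBasis.mk hp.orthonormal hp.dense_span.ge
  have hb : ∀ i, b i = (hp.memLp i).toLp (p i) := fun i => congrFun (HilbertBasis.coe_mk _ _) i
  have h := b.hasSum_inner_mul_inner (hg.toLp g) (hg.toLp g)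
  simp only [hb, real_inner_comm (hg.toLp g)] at h
  simp only [inner_toLp_eq_integral, ← sq] at h
  rw [← h.tsum_eq, ENNReal.ofReal_tsum_of_nonneg (fun i => sq_nonneg _) h.summable]

end Basis

/-! ### Orthonormality and Parseval for tensor products. -/

section Tensor

variable {X Y J K : Type*} [MeasurableSpace X] [MeasurableSpace Y]
  {μX : Measure X} {μY : Measure Y} [SigmaFinite μX] [SigmaFinite μY]
  {pX : J → X → ℝ} {pY : K → Y → ℝ}

/-- The tensor product `p_{jk}(x, y) = p_j(x) p_k(y)`. -/
def tensor (pX : J → X → ℝ) (pY : K → Y → ℝ) (q : J × K) (z : X × Y) : ℝ :=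
  pX q.1 z.1 * pY q.2 z.2

omit [SigmaFinite μX] [SigmaFinite μY] in
theorem memLp_tensor (hpX : IsL2Basis μX pX) (hpY : IsL2Basis μY pY) (q : J × K) :
    MemLp (tensor pX pY q) 2 (μX.prod μY) := by
  have hm : AEStronglyMeasurable (tensor pX pY q) (μX.prod μY) :=
    (hpX.memLp q.1).aestronglyMeasurable.comp_fst.mul
      (hpY.memLp q.2).aestronglyMeasurable.comp_snd
  rw [memLp_two_iff_integrable_sq hm]
  simp_rw [tensor, mul_pow]
  exact (hpX.memLp q.1).integrable_sq.mul_prod (hpY.memLp q.2).integrable_sq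

theorem integral_sq_sum_tensor (hpX : IsL2Basis μX pX) (hpY : IsL2Basis μY pY)
    (N : Finset (J × K)) (c : J × K → ℝ) :
    ∫ z, (∑ q ∈ N, c q * tensor pX pY q z) ^ 2 ∂(μX.prod μY) = ∑ q ∈ N, c q ^ 2 := by
  classical
  have h0 : ∀ q q', ∫ z, tensor pX pY q z * tensor pX pY q' z ∂(μX.prod μY)
      = if q = q' then 1 else 0 := fun q q' => by
    have : ∀ z : X × Y, tensor pX pY q z * tensor pX pY q' z
        = (pX q.1 z.1 * pX q'.1 z.1) * (pY q.2 z.2 * pY q'.2 z.2) := fun z => by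
      simp only [tensor]; ring
    simp_rw [this]
    rw [integral_prod_mul (fun x => pX q.1 x * pX q'.1 x) (fun y => pY q.2 y * pY q'.2 y),
      hpX.integral_mul, hpY.integral_mul]
    by_cases h1 : q.1 = q'.1 <;> by_cases h2 : q.2 = q'.2 <;> simp [h1, h2, Prod.ext_iff]
  have hi : ∀ q q', Integrable (fun z => (c q * c q') * (tensor pX pY q z * tensor pX pY q' z))
      (μX.prod μY) := fun q q' =>
    ((memLp_tensor hpX hpY q).integrable_mul (memLp_tensor hpX hpY q')).const_mul _
  have h1 : ∀ z, (∑ q ∈ N, c q * tensor pX pY q z) ^ 2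
      = ∑ q ∈ N, ∑ q' ∈ N, (c q * c q') * (tensor pX pY q z * tensor pX pY q' z) := fun z => by
    rw [sq, Finset.sum_mul_sum]
    exact Finset.sum_congr rfl fun q _ => Finset.sum_congr rfl fun q' _ => by ring
  simp_rw [h1]
  rw [integral_finsetSum _ fun q _ => integrable_finsetSum _ fun q' _ => hi q q']
  refine Finset.sum_congr rfl fun q hq => ?_
  rw [integral_finsetSum _ fun q' _ => hi q q']
  simp_rw [integral_const_mul, h0]
  simp [hq, sq]

/-- Parseval's identity for the tensor product of two orthonormal bases. -/
theorem tsum_tsum_sq_integral_tensor [Countable J] (hpX : IsL2Basis μX pX)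
    (hpY : IsL2Basis μY pY) {g : X × Y → ℝ} (hg : MemLp g 2 (μX.prod μY)) :
    ∑' j, ∑' k, ENNReal.ofReal ((∫ z, g z * tensor pX pY (j, k) z ∂(μX.prod μY)) ^ 2)
      = ENNReal.ofReal (∫ z, g z ^ 2 ∂(μX.prod μY)) := by
  have hsq := hg.integrable_sq
  have hswap : MemLp (fun z : Y × X => g z.swap) 2 (μY.prod μX) :=
    hg.comp_measurePreserving Measure.measurePreserving_swap
  have hsl : ∀ᵐ y ∂μY, MemLp (fun x => g (x, y)) 2 μX := by
    filter_upwards [hswap.aestronglyMeasurable.prodMk_left, hswap.integrable_sq.prod_right_ae]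
      with y h1 h2
    exact (memLp_two_iff_integrable_sq h1).2 h2
  -- Parseval in x on almost every slice, then Parseval in y for each coefficient function `c j`;
  -- completeness of the tensor system is never needed as such. That `c j` is in L² follows from the
  -- first identity, whose total is finite.
  let c : J → Y → ℝ := fun j y => ∫ x, g (x, y) * pX j x ∂μX
  have hcm : ∀ j, AEStronglyMeasurable (c j) μY := fun j =>
    AEStronglyMeasurable.integral_prod_right' (f := fun z : Y × X => g z.swap * pX j z.2)
      (hswap.aestronglyMeasurable.mul (hpX.memLp j).aestronglyMeasurable.comp_snd)
  have hstep : ENNReal.ofReal (∫ z, g z ^ 2 ∂(μX.prod μY))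
      = ∑' j, ∫⁻ y, ENNReal.ofReal (c j y ^ 2) ∂μY := by
    rw [integral_prod_symm _ hsq, ofReal_integral_eq_lintegral_ofReal hsq.integral_prod_right
      (ae_of_all _ fun y => integral_nonneg fun x => sq_nonneg _),
      ← lintegral_tsum fun j => ((hcm j).aemeasurable.pow_const 2).ennreal_ofReal]
    refine lintegral_congr_ae ?_
    filter_upwards [hsl] with y hy
    exact (hpX.tsum_sq_integral hy).symm
  rw [hstep]
  refine tsum_congr fun j => ?_
  have hfin : ∫⁻ y, ENNReal.ofReal (c j y ^ 2) ∂μY ≠ ∞ := by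
    refine ne_top_of_le_ne_top
      (ENNReal.ofReal_ne_top (r := ∫ z, g z ^ 2 ∂(μX.prod μY))) ?_
    rw [hstep]
    exact ENNReal.le_tsum j
  have hc : MemLp (c j) 2 μY := by
    rw [memLp_two_iff_integrable_sq (hcm j)]
    refine (lintegral_ofReal_ne_top_iff_integrable ((hcm j).pow 2)
      (ae_of_all _ fun y => sq_nonneg _)).1 hfin
  rw [← ofReal_integral_eq_lintegral_ofReal hc.integrable_sq (ae_of_all _ fun y => sq_nonneg _),
    ← hpY.tsum_sq_integral hc]
  refine tsum_congr fun k => ?_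
  congr 2
  have hi : Integrable (fun z => g z * tensor pX pY (j, k) z) (μX.prod μY) :=
    hg.integrable_mul (memLp_tensor hpX hpY (j, k))
  rw [integral_prod_symm _ hi]
  refine integral_congr_ae (ae_of_all _ fun y => ?_)
  simp only [c, tensor, ← mul_assoc]
  rw [integral_mul_const]

end Tensor

/-! ### The law with density f and its marginals, dominated by the base measures. -/

section Law

variable {X Y : Type*} [MeasurableSpace X] [MeasurableSpace Y]
  {μX : Measure X} {μY : Measure Y} [SigmaFinite μX] [SigmaFinite μY] {f : X × Y → ℝ} {A : ℝ}

omit [MeasurableSpace X] in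
theorem abs_le_of_supNorm_le (hA : 0 ≤ A) {g : X → ℝ} (h : supNorm g ≤ ENNReal.ofReal A) (x : X) :
    |g x| ≤ A := by
  have h1 : ‖g x‖ₑ ≤ ENNReal.ofReal A := (le_iSup (fun x => ‖g x‖ₑ) x).trans h
  rw [← ofReal_norm, ENNReal.ofReal_le_ofReal_iff hA] at h1
  exact h1

omit [SigmaFinite μX] [SigmaFinite μY] in
theorem IsDensity.integrable (hf : IsDensity μX μY f) : Integrable f (μX.prod μY) := by
  by_contra h
  have := hf.2.2
  rw [integral_undef h] at this
  exact zero_ne_one this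

omit [SigmaFinite μX] [SigmaFinite μY] in
theorem IsDensity.isProbabilityMeasure_law (hf : IsDensity μX μY f) :
    IsProbabilityMeasure (law μX μY f) := by
  constructor
  rw [law, withDensity_apply _ MeasurableSet.univ, setLIntegral_univ,
    ← ofReal_integral_eq_lintegral_ofReal hf.integrable hf.2.1, hf.2.2, ENNReal.ofReal_one]

omit [SigmaFinite μX] [SigmaFinite μY] in
theorem law_le (hA : ∀ z, |f z| ≤ A) : law μX μY f ≤ ENNReal.ofReal A • μX.prod μY := by
  rw [← withDensity_const]
  exact withDensity_mono (ae_of_all _ fun z =>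
    ENNReal.ofReal_le_ofReal ((le_abs_self _).trans (hA z)))

theorem map_fst_law_le (hf : IsDensity μX μY f) (hA : ∀ x, |margX μY f x| ≤ A) :
    (law μX μY f).map Prod.fst ≤ ENNReal.ofReal A • μX := by
  refine Measure.le_iff.2 fun s hs => ?_
  have hm : AEMeasurable (fun z => ENNReal.ofReal (f z)) (μX.prod μY) :=
    hf.1.aestronglyMeasurable.aemeasurable.ennreal_ofReal
  rw [Measure.map_apply measurable_fst hs, law, withDensity_apply _ (measurable_fst hs),
    ← prod_univ, ← Measure.prod_restrict, Measure.restrict_univ, lintegral_prod]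
  · calc _ ≤ ∫⁻ _ in s, ENNReal.ofReal A ∂μX := by
          refine lintegral_mono_ae (ae_restrict_of_ae ?_)
          filter_upwards [hf.integrable.prod_right_ae, Measure.ae_ae_of_ae_prod hf.2.1] with x h1 h2
          rw [← ofReal_integral_eq_lintegral_ofReal h1 h2]
          exact ENNReal.ofReal_le_ofReal ((le_abs_self _).trans (hA x))
      _ = _ := by simp
  · have h := hm.restrict (s := s ×ˢ univ)
    rwa [← Measure.prod_restrict, Measure.restrict_univ] at h

theorem law_map_swap (f : X × Y → ℝ) :
    (law μX μY f).map Prod.swap = law μY μX (fun z => f z.swap) := by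
  ext s hs
  rw [Measure.map_apply measurable_swap hs, law, law, withDensity_apply _ (measurable_swap hs),
    withDensity_apply _ hs]
  have h := (Measure.measurePreserving_swap (μ := μX) (ν := μY)).setLIntegral_comp_preimage_emb
    MeasurableEquiv.prodComm.measurableEmbedding (fun z => ENNReal.ofReal (f z.swap)) s
  simpa using h

theorem IsDensity.swap (hf : IsDensity μX μY f) : IsDensity μY μX (fun z => f z.swap) := by
  have hp : MeasurePreserving Prod.swap (μY.prod μX) (μX.prod μY) := Measure.measurePreserving_swap
  refine ⟨hf.1.comp_measurePreserving hp, hp.quasiMeasurePreserving.ae hf.2.1, ?_⟩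
  rw [← hf.2.2]
  exact hp.integral_comp MeasurableEquiv.prodComm.measurableEmbedding f

theorem map_snd_law_le (hf : IsDensity μX μY f) (hA : ∀ y, |margY μX f y| ≤ A) :
    (law μX μY f).map Prod.snd ≤ ENNReal.ofReal A • μY := by
  have h := map_fst_law_le hf.swap hA
  rw [← law_map_swap, Measure.map_map measurable_fst measurable_swap] at h
  exact h

omit [SigmaFinite μX] [SigmaFinite μY] in
theorem integral_law (hf : IsDensity μX μY f) (g : X × Y → ℝ) :
    ∫ z, g z ∂(law μX μY f) = ∫ z, f z * g z ∂(μX.prod μY) := by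
  rw [law, integral_withDensity_eq_integral_toReal_smul₀
    hf.1.aestronglyMeasurable.aemeasurable.ennreal_ofReal (ae_of_all _ fun _ => ENNReal.ofReal_lt_top)]
  refine integral_congr_ae ?_
  filter_upwards [hf.2.1] with z hz
  rw [ENNReal.toReal_ofReal hz, smul_eq_mul]

omit [SigmaFinite μX] [SigmaFinite μY] in
theorem integrable_law_iff (hf : IsDensity μX μY f) (g : X × Y → ℝ) :
    Integrable g (law μX μY f) ↔ Integrable (fun z => f z * g z) (μX.prod μY) := by
  rw [law, integrable_withDensity_iff_integrable_smul₀'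
    hf.1.aestronglyMeasurable.aemeasurable.ennreal_ofReal (ae_of_all _ fun _ => ENNReal.ofReal_lt_top)]
  refine integrable_congr ?_
  filter_upwards [hf.2.1] with z hz
  rw [ENNReal.toReal_ofReal hz, smul_eq_mul]

theorem integral_map_fst_law (hf : IsDensity μX μY f) (hA : ∀ x, |margX μY f x| ≤ A)
    {g : X → ℝ} (hg : MemLp g 2 μX) :
    ∫ x, g x ∂((law μX μY f).map Prod.fst) = ∫ x, margX μY f x * g x ∂μX := by
  have := hf.isProbabilityMeasure_law
  have : IsProbabilityMeasure ((law μX μY f).map Prod.fst) :=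
    Measure.isProbabilityMeasure_map measurable_fst.aemeasurable
  have hg2 : MemLp g 2 ((law μX μY f).map Prod.fst) :=
    hg.of_measure_le_smul ENNReal.ofReal_ne_top (map_fst_law_le hf hA)
  rw [integral_map measurable_fst.aemeasurable hg2.aestronglyMeasurable, integral_law hf]
  have hi : Integrable (fun z : X × Y => g z.1) (law μX μY f) :=
    (integrable_map_measure hg2.aestronglyMeasurable measurable_fst.aemeasurable).1
      (hg2.integrable one_le_two)
  rw [integral_prod _ ((integrable_law_iff hf _).1 hi)]
  simp_rw [integral_mul_const]
  rfl

theorem integral_map_snd_law (hf : IsDensity μX μY f) (hA : ∀ y, |margY μX f y| ≤ A)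
    {g : Y → ℝ} (hg : MemLp g 2 μY) :
    ∫ y, g y ∂((law μX μY f).map Prod.snd) = ∫ y, margY μX f y * g y ∂μY := by
  have h := integral_map_fst_law hf.swap hA hg
  rw [← law_map_swap, Measure.map_map measurable_fst measurable_swap] at h
  exact h

theorem integral_sq_le_of_map_le {W Z : Type*} [MeasurableSpace W] [MeasurableSpace Z]
    {Q : Measure W} {μ : Measure Z} {φ : W → Z} (hφ : Measurable φ) {c : ℝ} (hc : 0 ≤ c)
    (h : Q.map φ ≤ ENNReal.ofReal c • μ) {g : Z → ℝ} (hg : MemLp g 2 μ) :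
    MemLp (fun u => g (φ u)) 2 Q ∧ ∫ u, g (φ u) ^ 2 ∂Q ≤ c * ∫ z, g z ^ 2 ∂μ := by
  have h1 : MemLp g 2 (Q.map φ) := hg.of_measure_le_smul ENNReal.ofReal_ne_top h
  refine ⟨(memLp_map_measure_iff h1.aestronglyMeasurable hφ.aemeasurable).1 h1, ?_⟩
  have h2 : ∫ u, g (φ u) ^ 2 ∂Q = ∫ z, g z ^ 2 ∂(Q.map φ) :=
    (integral_map hφ.aemeasurable (h1.aestronglyMeasurable.pow 2)).symm
  rw [h2]
  calc _ ≤ ∫ z, g z ^ 2 ∂(ENNReal.ofReal c • μ) :=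
        integral_mono_measure h (ae_of_all _ fun z => sq_nonneg _)
          (hg.integrable_sq.smul_measure ENNReal.ofReal_ne_top)
    _ = _ := by rw [integral_smul_measure, ENNReal.toReal_ofReal hc, smul_eq_mul]

end Law

/-! ### Interaction contrasts: symmetry, second moments and means. -/

section Contrast

variable {X Y J K : Type*}

/-- The interaction contrast of `g` at a pair of observations. -/
def contrast (g : X × Y → ℝ) (u : (X × Y) × (X × Y)) : ℝ :=
  g u.1 - g (u.1.1, u.2.2) - g (u.2.1, u.1.2) + g u.2

/-- Exchange the second coordinates of a pair of observations. -/
def swapSnd (u : (X × Y) × (X × Y)) : (X × Y) × (X × Y) := ((u.1.1, u.2.2), (u.2.1, u.1.2))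

theorem contrast_swapSnd (g : X × Y → ℝ) (u : (X × Y) × (X × Y)) :
    contrast g (swapSnd u) = -contrast g u := by
  simp only [contrast, swapSnd]
  ring

theorem contrast_sum (N : Finset J) (c : J → ℝ) (g : J → X × Y → ℝ) (u : (X × Y) × (X × Y)) :
    ∑ q ∈ N, c q * contrast (g q) u = contrast (fun z => ∑ q ∈ N, c q * g q z) u := by
  simp only [contrast, ← Finset.sum_sub_distrib, ← Finset.sum_add_distrib]
  exact Finset.sum_congr rfl fun q _ => by ring

variable [MeasurableSpace X] [MeasurableSpace Y]

theorem measurable_contrast {g : X × Y → ℝ} (hg : Measurable g) : Measurable (contrast g) := by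
  unfold contrast
  fun_prop

theorem map_cross_prod (P : Measure (X × Y)) [IsProbabilityMeasure P] :
    (P.prod P).map (fun u => (u.1.1, u.2.2)) = (P.map Prod.fst).prod (P.map Prod.snd) :=
  (Measure.map_prod_map P P measurable_fst measurable_snd).symm

theorem map_cross_prod' (P : Measure (X × Y)) [IsProbabilityMeasure P] :
    (P.prod P).map (fun u => (u.2.1, u.1.2)) = (P.map Prod.fst).prod (P.map Prod.snd) := by
  rw [← map_cross_prod]
  conv_rhs => rw [← (Measure.measurePreserving_swap (μ := P) (ν := P)).map_eq]
  rw [Measure.map_map (by fun_prop) measurable_swap]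
  rfl

/-- After reassociation this exchanges the two factors `PY` of a fourfold product. -/
theorem measurePreserving_swapSnd_prod (PX : Measure X) (PY : Measure Y) [SFinite PX]
    [SFinite PY] : MeasurePreserving (swapSnd : (X × Y) × (X × Y) → _)
      ((PX.prod PY).prod (PX.prod PY)) ((PX.prod PY).prod (PX.prod PY)) := by
  have h1 := measurePreserving_prodAssoc PX PY (PX.prod PY)
  have h2 := (measurePreserving_prodAssoc PY PX PY).comp
    (((Measure.measurePreserving_swap (μ := PX) (ν := PY)).prod (MeasurePreserving.id PY)).comp
      (Measure.measurePreserving_swap (μ := PY) (ν := PX.prod PY)))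
  exact h1.symm.comp (((MeasurePreserving.id PX).prod h2).comp h1)

/-- Under the null hypothesis, exchanging the second coordinates preserves the law of a pair of
observations. -/
theorem measurePreserving_swapSnd {P : Measure (X × Y)} (hP : P ∈ nullLaws X Y) :
    MeasurePreserving swapSnd (P.prod P) (P.prod P) := by
  have := hP.1
  have hprod : (P.map Prod.fst).prod (P.map Prod.snd) = P := by
    rw [← (indepFun_iff_map_prod_eq_prod_map_map measurable_fst.aemeasurable
      measurable_snd.aemeasurable).1 hP.2]
    exact Measure.map_id
  have h := measurePreserving_swapSnd_prod (P.map Prod.fst) (P.map Prod.snd)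
  rwa [hprod] at h

variable {μX : Measure X} {μY : Measure Y} [SigmaFinite μX] [SigmaFinite μY] {f : X × Y → ℝ}
  {A : ℝ}

/-- `f` is a density which is bounded by `A` together with its marginals. -/
structure IsBoundedDensity (μX : Measure X) (μY : Measure Y) (f : X × Y → ℝ) (A : ℝ) : Prop where
  isDensity : IsDensity μX μY f
  bound : ∀ z, |f z| ≤ A
  boundX : ∀ x, |margX μY f x| ≤ A
  boundY : ∀ y, |margY μX f y| ≤ A

theorem IsBoundedDensity.cross_le (hf : IsBoundedDensity μX μY f A) (hA : 1 ≤ A) :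
    ((law μX μY f).map Prod.fst).prod ((law μX μY f).map Prod.snd)
      ≤ ENNReal.ofReal (A ^ 2) • μX.prod μY := by
  have := hf.isDensity.isProbabilityMeasure_law
  calc _ ≤ (ENNReal.ofReal A • μX).prod (ENNReal.ofReal A • μY) :=
        Measure.prod_mono (map_fst_law_le hf.isDensity hf.boundX)
          (map_snd_law_le hf.isDensity hf.boundY)
    _ = _ := by
        rw [Measure.prod_smul_left, Measure.prod_smul_right, smul_smul, sq,
          ENNReal.ofReal_mul (by linarith)]

omit [SigmaFinite μX] [SigmaFinite μY] in
theorem IsBoundedDensity.law_le_sq (hf : IsBoundedDensity μX μY f A) (hA : 1 ≤ A) :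
    law μX μY f ≤ ENNReal.ofReal (A ^ 2) • μX.prod μY := by
  refine (law_le fun z => (hf.bound z).trans ?_)
  nlinarith

/-- Contrasts of square integrable functions are square integrable, uniformly over bounded
densities. -/
theorem IsBoundedDensity.contrast_sq (hf : IsBoundedDensity μX μY f A) (hA : 1 ≤ A)
    {g : X × Y → ℝ} (hg : MemLp g 2 (μX.prod μY)) :
    MemLp (contrast g) 2 ((law μX μY f).prod (law μX μY f)) ∧
      ∫ u, contrast g u ^ 2 ∂((law μX μY f).prod (law μX μY f))
        ≤ 16 * A ^ 2 * ∫ z, g z ^ 2 ∂(μX.prod μY) := by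
  have := hf.isDensity.isProbabilityMeasure_law
  set P := law μX μY f
  have hA2 : 0 ≤ A ^ 2 := sq_nonneg A
  -- Each of the four points entering the contrast has a law dominated by A²μ: the observations
  -- through f ≤ A and 1 ≤ A, the crossed points through the marginals. With (a+b+c+d)² ≤
  -- 4(a²+b²+c²+d²) this yields the factor 16A².
  obtain ⟨m1, i1⟩ := integral_sq_le_of_map_le (Q := P.prod P) (φ := fun u => u.1) measurable_fst
    hA2 (by rw [(measurePreserving_fst (μ := P) (ν := P)).map_eq]; exact hf.law_le_sq hA) hg
  obtain ⟨m2, i2⟩ := integral_sq_le_of_map_le (Q := P.prod P) (φ := fun u => u.2) measurable_snd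
    hA2 (by rw [(measurePreserving_snd (μ := P) (ν := P)).map_eq]; exact hf.law_le_sq hA) hg
  obtain ⟨m3, i3⟩ := integral_sq_le_of_map_le (Q := P.prod P) (φ := fun u => (u.1.1, u.2.2))
    (by fun_prop) hA2 (by rw [map_cross_prod]; exact hf.cross_le hA) hg
  obtain ⟨m4, i4⟩ := integral_sq_le_of_map_le (Q := P.prod P) (φ := fun u => (u.2.1, u.1.2))
    (by fun_prop) hA2 (by rw [map_cross_prod']; exact hf.cross_le hA) hg
  have hm : MemLp (contrast g) 2 (P.prod P) := ((m1.sub m3).sub m4).add m2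
  refine ⟨hm, ?_⟩
  have j1 := m1.integrable_sq
  have j2 := m2.integrable_sq
  have j3 := m3.integrable_sq
  have j4 := m4.integrable_sq
  have j13 : Integrable (fun u : (X × Y) × (X × Y) => g u.1 ^ 2 + g (u.1.1, u.2.2) ^ 2)
      (P.prod P) := j1.add j3
  have j134 : Integrable (fun u : (X × Y) × (X × Y) => g u.1 ^ 2 + g (u.1.1, u.2.2) ^ 2
      + g (u.2.1, u.1.2) ^ 2) (P.prod P) := j13.add j4
  calc _ ≤ ∫ u, 4 * (g u.1 ^ 2 + g (u.1.1, u.2.2) ^ 2 + g (u.2.1, u.1.2) ^ 2 + g u.2 ^ 2)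
          ∂(P.prod P) := by
        refine integral_mono hm.integrable_sq ((j134.add j2).const_mul 4)
          fun u => ?_
        simp only [contrast]
        nlinarith [sq_nonneg (g u.1 + g (u.1.1, u.2.2)), sq_nonneg (g u.1 + g (u.2.1, u.1.2)),
          sq_nonneg (g u.1 - g u.2), sq_nonneg (g (u.1.1, u.2.2) - g (u.2.1, u.1.2)),
          sq_nonneg (g (u.1.1, u.2.2) + g u.2), sq_nonneg (g (u.2.1, u.1.2) + g u.2)]
    _ = 4 * (∫ u, g u.1 ^ 2 ∂(P.prod P) + ∫ u, g (u.1.1, u.2.2) ^ 2 ∂(P.prod P)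
          + ∫ u, g (u.2.1, u.1.2) ^ 2 ∂(P.prod P) + ∫ u, g u.2 ^ 2 ∂(P.prod P)) := by
        rw [integral_const_mul, integral_add j134 j2, integral_add j13 j4,
          integral_add j1 j3]
    _ ≤ _ := by linarith

/-- The coefficient `a_{jk} - a_{j•} a_{•k}` of `f - f_X f_Y`. -/
def depCoef (μX : Measure X) (μY : Measure Y) (pX : J → X → ℝ) (pY : K → Y → ℝ)
    (f : X × Y → ℝ) (q : J × K) : ℝ :=
  coef μX μY pX pY f q.1 q.2 - coefX μX μY pX f q.1 * coefY μX μY pY f q.2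

variable {pX : J → X → ℝ} {pY : K → Y → ℝ}

theorem IsBoundedDensity.integral_cross (hf : IsBoundedDensity μX μY f A)
    (hpX : IsL2Basis μX pX) (hpY : IsL2Basis μY pY) (q : J × K) :
    ∫ z, tensor pX pY q z ∂(((law μX μY f).map Prod.fst).prod ((law μX μY f).map Prod.snd))
      = coefX μX μY pX f q.1 * coefY μX μY pY f q.2 := by
  have := hf.isDensity.isProbabilityMeasure_law
  simp only [tensor]
  rw [integral_prod_mul, integral_map_fst_law hf.isDensity hf.boundX (hpX.memLp _),
    integral_map_snd_law hf.isDensity hf.boundY (hpY.memLp _)]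
  rfl

omit [SigmaFinite μX] [SigmaFinite μY] in
theorem measurable_tensor (hpX : IsL2Basis μX pX) (hpY : IsL2Basis μY pY) (q : J × K) :
    Measurable (tensor pX pY q) :=
  ((hpX.measurable q.1).comp measurable_fst).mul ((hpY.measurable q.2).comp measurable_snd)

/-- Two of the four points are distributed as f, and the two crossed points as the product of its
marginals. -/
theorem IsBoundedDensity.integral_contrast (hf : IsBoundedDensity μX μY f A) (hA : 1 ≤ A)
    (hpX : IsL2Basis μX pX) (hpY : IsL2Basis μY pY) (q : J × K) :
    ∫ u, contrast (tensor pX pY q) u ∂((law μX μY f).prod (law μX μY f))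
      = 2 * depCoef μX μY pX pY f q := by
  have := hf.isDensity.isProbabilityMeasure_law
  have hc := hf.integral_cross hpX hpY q
  have hl := hf.law_le_sq hA
  have hl2 := hf.cross_le hA
  set P := law μX μY f with hP
  have hg := memLp_tensor hpX hpY q
  have hgm := measurable_tensor hpX hpY q
  have hA2 : 0 ≤ A ^ 2 := sq_nonneg A
  have e1 := (measurePreserving_fst (μ := P) (ν := P)).map_eq
  have e2 := (measurePreserving_snd (μ := P) (ν := P)).map_eq
  have e3 := map_cross_prod P
  have e4 := map_cross_prod' P
  have m1 := (integral_sq_le_of_map_le (Q := P.prod P) (φ := fun u => u.1) measurable_fst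
    hA2 (by rw [e1]; exact hl) hg).1.integrable one_le_two
  have m2 := (integral_sq_le_of_map_le (Q := P.prod P) (φ := fun u => u.2) measurable_snd
    hA2 (by rw [e2]; exact hl) hg).1.integrable one_le_two
  have m3 := (integral_sq_le_of_map_le (Q := P.prod P) (φ := fun u => (u.1.1, u.2.2))
    (by fun_prop) hA2 (by rw [e3]; exact hl2) hg).1.integrable one_le_two
  have m4 := (integral_sq_le_of_map_le (Q := P.prod P) (φ := fun u => (u.2.1, u.1.2))
    (by fun_prop) hA2 (by rw [e4]; exact hl2) hg).1.integrable one_le_two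
  have hcoef : ∫ z, tensor pX pY q z ∂P = coef μX μY pX pY f q.1 q.2 :=
    integral_law hf.isDensity _
  have i1 := integral_map (μ := P.prod P) (φ := fun u => u.1) measurable_fst.aemeasurable
    hgm.aestronglyMeasurable
  have i2 := integral_map (μ := P.prod P) (φ := fun u => u.2) measurable_snd.aemeasurable
    hgm.aestronglyMeasurable
  have i3 := integral_map (μ := P.prod P) (φ := fun u => (u.1.1, u.2.2))
    (by fun_prop) hgm.aestronglyMeasurable
  have i4 := integral_map (μ := P.prod P) (φ := fun u => (u.2.1, u.1.2))
    (by fun_prop) hgm.aestronglyMeasurable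
  rw [e1, hcoef] at i1
  rw [e2, hcoef] at i2
  rw [e3, hc] at i3
  rw [e4, hc] at i4
  simp only [contrast]
  have m13 : Integrable (fun u : (X × Y) × (X × Y) => tensor pX pY q u.1
      - tensor pX pY q (u.1.1, u.2.2)) (P.prod P) := m1.sub m3
  have m134 : Integrable (fun u : (X × Y) × (X × Y) => tensor pX pY q u.1
      - tensor pX pY q (u.1.1, u.2.2) - tensor pX pY q (u.2.1, u.1.2)) (P.prod P) := m13.sub m4
  rw [integral_add m134 m2, integral_sub m13 m4, integral_sub m1 m3,
    ← i1, ← i2, ← i3, ← i4, depCoef]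
  ring

omit [SigmaFinite μX] in
theorem IsDensity.memLp_margX (hf : IsDensity μX μY f) (hA : ∀ x, |margX μY f x| ≤ A) :
    MemLp (margX μY f) 2 μX := by
  have hi : Integrable (margX μY f) μX := hf.integrable.integral_prod_left
  rw [memLp_two_iff_integrable_sq hi.aestronglyMeasurable]
  refine (hi.norm.const_mul A).mono' (hi.aestronglyMeasurable.pow 2) (ae_of_all _ fun x => ?_)
  rw [Real.norm_of_nonneg (sq_nonneg _), ← sq_abs, sq, Real.norm_eq_abs]
  exact mul_le_mul_of_nonneg_right (hA x) (abs_nonneg _)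

theorem IsBoundedDensity.memLp_dep (hf : IsBoundedDensity μX μY f A) :
    MemLp (fun z => margX μY f z.1 * margY μX f z.2) 2 (μX.prod μY) := by
  have hX := hf.isDensity.memLp_margX hf.boundX
  have hY : MemLp (margY μX f) 2 μY := hf.isDensity.swap.memLp_margX hf.boundY
  have hm : AEStronglyMeasurable (fun z => margX μY f z.1 * margY μX f z.2) (μX.prod μY) :=
    hX.aestronglyMeasurable.comp_fst.mul hY.aestronglyMeasurable.comp_snd
  rw [memLp_two_iff_integrable_sq hm]
  simp_rw [mul_pow]
  exact hX.integrable_sq.mul_prod hY.integrable_sq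

/-- The measure of dependence as the sum of its squared coefficients. -/
theorem IsBoundedDensity.tsum_sq_depCoef [Countable J] (hf : IsBoundedDensity μX μY f A)
    (hpX : IsL2Basis μX pX) (hpY : IsL2Basis μY pY) :
    ∑' q, ENNReal.ofReal (depCoef μX μY pX pY f q ^ 2)
      = ENNReal.ofReal (dependence μX μY f) := by
  rw [ENNReal.tsum_prod']
  refine Eq.trans ?_ (tsum_tsum_sq_integral_tensor hpX hpY (hf.isDensity.1.sub hf.memLp_dep))
  refine tsum_congr fun j => tsum_congr fun k => ?_
  congr 2
  have ht := memLp_tensor hpX hpY (j, k)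
  have h1 : Integrable (fun z => f z * tensor pX pY (j, k) z) (μX.prod μY) :=
    hf.isDensity.1.integrable_mul ht
  have h2 : Integrable (fun z => margX μY f z.1 * margY μX f z.2 * tensor pX pY (j, k) z)
      (μX.prod μY) := hf.memLp_dep.integrable_mul ht
  simp only [sub_mul]
  rw [integral_sub h1 h2]
  have : ∀ z : X × Y, margX μY f z.1 * margY μX f z.2 * tensor pX pY (j, k) z
      = (margX μY f z.1 * pX j z.1) * (margY μX f z.2 * pY k z.2) := fun z => by
    simp only [tensor]; ring
  simp_rw [this]
  rw [integral_prod_mul (fun x => margX μY f x * pX j x) (fun y => margY μX f y * pY k y)]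
  rfl

end Contrast

/-! ### Pointwise control of the contrast kernel by ‖h_M‖. -/

section KernelNorm

variable {X Y J K : Type*} {pX : J → X → ℝ} {pY : K → Y → ℝ} {M : Set (J × K)}

/-- Finiteness of `‖h_M‖_∞` controls the feature kernel of the contrasts pointwise: the summands
of the latter are combinations of sixteen summands of `h_M`. -/
theorem featureKernel_contrast_bound {h : ℝ} (h0 : 0 ≤ h)
    (hM : kernelSupNorm pX pY M ≤ ENNReal.ofReal h) (u v : (X × Y) × (X × Y)) :
    Summable (fun q : M => contrast (tensor pX pY q) u * contrast (tensor pX pY q) v) ∧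
      |∑' q : M, contrast (tensor pX pY q) u * contrast (tensor pX pY q) v| ≤ 16 * h := by
  have hs : ∀ z : Fin 4 → X × Y, Summable (fun q : M => kernelTerm pX pY q.1 z) := by
    by_contra hcon
    rw [kernelSupNorm, if_neg hcon] at hM
    exact absurd hM (not_le.2 ENNReal.ofReal_lt_top)
  rw [kernelSupNorm, if_pos hs] at hM
  have hk : ∀ z, |∑' q : M, kernelTerm pX pY q.1 z| ≤ h := fun z => by
    have h1 : ‖kernel pX pY M z‖ₑ ≤ ENNReal.ofReal h :=
      (le_iSup (fun z => ‖kernel pX pY M z‖ₑ) z).trans hM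
    rw [← ofReal_norm, ENNReal.ofReal_le_ofReal_iff h0] at h1
    exact h1
  have hD : ∀ (x x' : X) (y : Y), ∃ s, |s| ≤ 2 * h ∧
      HasSum (fun q : M => pX q.1.1 x * pX q.1.1 x' * pY q.1.2 y *
        (pY q.1.2 v.1.2 - pY q.1.2 v.2.2)) s := fun x x' y => by
    -- At these points the summand of h_M collapses to -p(x,y)² + p(x,y)p(x',y'). Subtracting two
    -- choices of y' removes the square, at the price of 2h; eight such differences make up the
    -- product of contrasts, hence 16h.
    let z : Y → Fin 4 → X × Y := fun y' => ![(x, y), (x, y), (x', y), (x', y')]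
    refine ⟨_, ?_, ((hs (z v.1.2)).hasSum.sub (hs (z v.2.2)).hasSum).congr_fun fun q => ?_⟩
    · have h1 := abs_le.1 (hk (z v.1.2))
      have h2 := abs_le.1 (hk (z v.2.2))
      rw [abs_le]
      constructor <;> linarith
    · simp [kernelTerm, z]
      ring
  obtain ⟨s1, b1, e1⟩ := hD u.1.1 v.1.1 u.1.2
  obtain ⟨s2, b2, e2⟩ := hD u.1.1 v.1.1 u.2.2
  obtain ⟨s3, b3, e3⟩ := hD u.1.1 v.2.1 u.1.2
  obtain ⟨s4, b4, e4⟩ := hD u.1.1 v.2.1 u.2.2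
  obtain ⟨s5, b5, e5⟩ := hD u.2.1 v.1.1 u.1.2
  obtain ⟨s6, b6, e6⟩ := hD u.2.1 v.1.1 u.2.2
  obtain ⟨s7, b7, e7⟩ := hD u.2.1 v.2.1 u.1.2
  obtain ⟨s8, b8, e8⟩ := hD u.2.1 v.2.1 u.2.2
  have hsum : HasSum (fun q : M => contrast (tensor pX pY q) u * contrast (tensor pX pY q) v)
      (((s1 - s2) - (s3 - s4)) - ((s5 - s6) - (s7 - s8))) := by
    refine (((e1.sub e2).sub (e3.sub e4)).sub ((e5.sub e6).sub (e7.sub e8))).congr_fun fun q => ?_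
    simp only [contrast, tensor]
    ring
  refine ⟨hsum.summable, ?_⟩
  rw [hsum.tsum_eq]
  rw [abs_le] at *
  constructor <;> linarith

end KernelNorm

/-! ### The test and its validity. -/

section Test

variable {X Y : Type*} [MeasurableSpace X] [MeasurableSpace Y]

/-- A kernel which is odd under exchanging the second coordinates of a pair of observations gives a
valid test of independence, for which the sample is split into two blocks of `m` pairs. -/
theorem exists_validTest {k : (X × Y) × (X × Y) → (X × Y) × (X × Y) → ℝ}
    (hk : Measurable (Function.uncurry k)) (hodd : ∀ u v, k (swapSnd u) v = -k u v)
    {m n : ℕ} (hmn : 4 * m ≤ n) {α : ℝ} (hα : 0 < α) :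
    ∃ ψ ∈ validTests X Y n α, ∀ (P : Measure (X × Y)) [IsProbabilityMeasure P],
      expect P (fun z => 1 - ψ z) = ((Measure.pi fun _ : Fin m => P.prod P).prod
        (Measure.pi fun _ : Fin m => P.prod P)).real
          {p | α * (∑ i, ∑ l, k (p.1 i) (p.2 l)) ^ 2 ≤ ∑ i, (∑ l, k (p.1 i) (p.2 l)) ^ 2} := by
  obtain ⟨Φ, hΦ, hΦP⟩ := exists_pairing hmn (X × Y)
  let T : (Fin m → (X × Y) × (X × Y)) × (Fin m → (X × Y) × (X × Y)) → ℝ :=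
    fun p => ∑ i, ∑ l, k (p.1 i) (p.2 l)
  let V : (Fin m → (X × Y) × (X × Y)) × (Fin m → (X × Y) × (X × Y)) → ℝ :=
    fun p => ∑ i, (∑ l, k (p.1 i) (p.2 l)) ^ 2
  have hkil : ∀ i l, Measurable fun p : (Fin m → (X × Y) × (X × Y)) ×
      (Fin m → (X × Y) × (X × Y)) => k (p.1 i) (p.2 l) := fun i l =>
    hk.comp (by fun_prop : Measurable fun p : (Fin m → (X × Y) × (X × Y)) ×
      (Fin m → (X × Y) × (X × Y)) => (p.1 i, p.2 l))
  have hT : Measurable T :=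
    Finset.measurable_sum _ fun i _ => Finset.measurable_sum _ fun l _ => hkil i l
  have hV : Measurable V :=
    Finset.measurable_sum _ fun i _ => (Finset.measurable_sum _ fun l _ => hkil i l).pow_const 2
  let S := {p | V p < α * T p ^ 2}
  have hS : MeasurableSet S := measurableSet_lt hV (by fun_prop)
  have hind : ∀ z, (Φ ⁻¹' S).indicator (fun _ => (1 : ℝ)) z = S.indicator (fun _ => 1) (Φ z) :=
    fun z => rfl
  refine ⟨(Φ ⁻¹' S).indicator fun _ => 1,
    ⟨measurable_const.indicator (hΦ hS), fun z => ?_, fun P hP => ?_⟩, fun P _ => ?_⟩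
  · by_cases hz : z ∈ Φ ⁻¹' S <;> simp [hz]
  · have := hP.1
    rw [expect, integral_indicator_const _ (hΦ hS), smul_eq_mul, mul_one,
      (hΦP P).measureReal_preimage hS.nullMeasurableSet, measureReal_def,
      Measure.prod_apply_symm hS]
    refine ENNReal.toReal_le_of_le_ofReal hα.le ?_
    calc _ ≤ ∫⁻ _, ENNReal.ofReal α ∂(Measure.pi fun _ : Fin m => P.prod P) := by
          -- Conditionally on the second block `v`, the first block is summed through a fixed odd
          -- function, so the level bound holds for every `v`.
          refine lintegral_mono fun v => ?_
          have h := measureReal_selfNormalized_le (P.prod P) (measurePreserving_swapSnd hP)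
            (g := fun u => ∑ l, k u (v l))
            (Finset.measurable_sum _ fun l _ => hk.comp measurable_prodMk_right)
            (fun u => by simp_rw [hodd, Finset.sum_neg_distrib]) m hα
          rw [measureReal_def] at h
          exact (ENNReal.le_ofReal_iff_toReal_le (measure_ne_top _ _) hα.le).2 h
      _ = _ := by simp
  · have hc : ∀ z, 1 - (Φ ⁻¹' S).indicator (fun _ => (1 : ℝ)) z
        = (Φ ⁻¹' Sᶜ).indicator (fun _ => (1 : ℝ)) z := fun z => by
      by_cases hz : Φ z ∈ S <;> simp [indicator, hz]
    simp_rw [hc]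
    rw [expect, integral_indicator_const _ (hΦ hS.compl), smul_eq_mul, mul_one,
      (hΦP P).measureReal_preimage hS.compl.nullMeasurableSet]
    congr 1
    ext p
    simp [S, T, V]

end Test

/-! ### Truncation bias and the risk over the alternatives. -/

section Risk

variable {X Y J K : Type*} [MeasurableSpace X] [MeasurableSpace Y]
  {μX : Measure X} {μY : Measure Y} [SigmaFinite μX] [SigmaFinite μY]
  {pX : J → X → ℝ} {pY : K → Y → ℝ} {θ : J → K → ℝ≥0∞} {r A ρ R : ℝ} {M : Set (J × K)}
  {f : X × Y → ℝ}

omit [SigmaFinite μX] [SigmaFinite μY] in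
theorem isBoundedDensity_of_mem_altClass (hA : 0 ≤ A)
    (hf : f ∈ altClass μX μY pX pY θ r A ρ) : IsBoundedDensity μX μY f A :=
  ⟨hf.1, abs_le_of_supNorm_le hA hf.2.2.2.1, abs_le_of_supNorm_le hA hf.2.2.2.2.1,
    abs_le_of_supNorm_le hA hf.2.2.2.2.2⟩

omit [SigmaFinite μX] [SigmaFinite μY] in
/-- The smoothness constraint bounds the squared coefficients outside of `M`. -/
theorem tsum_compl_sq_depCoef_le (hr : 0 < r)
    (hf : f ∈ altClass μX μY pX pY θ r A ρ)
    (hM : ∀ q ∉ M, ENNReal.ofReal r ≤ ENNReal.ofReal R * θ q.1 q.2) :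
    ∑' q : ↥Mᶜ, ENNReal.ofReal (depCoef μX μY pX pY f q ^ 2) ≤ ENNReal.ofReal R ^ 2 := by
  have hr0 : ENNReal.ofReal r ^ 2 ≠ 0 := by simpa using hr
  have hrt : ENNReal.ofReal r ^ 2 ≠ ∞ := by simp
  -- Multiplying through by r² avoids dividing by the weights, which may be 0 or ∞.
  refine (ENNReal.mul_le_mul_iff_right hr0 hrt).1 ?_
  have hS := hf.2.2.1
  rw [smoothness, ENNReal.ofReal_pow hr.le] at hS
  calc _ = ∑' q : ↥Mᶜ, ENNReal.ofReal r ^ 2 * ENNReal.ofReal (depCoef μX μY pX pY f q ^ 2) :=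
        ENNReal.tsum_mul_left.symm
    _ ≤ ∑' q : ↥Mᶜ, ENNReal.ofReal R ^ 2 * (θ q.1.1 q.1.2 ^ 2
          * ENNReal.ofReal (depCoef μX μY pX pY f q ^ 2)) := by
        refine ENNReal.tsum_le_tsum fun q => ?_
        rw [← mul_assoc, ← mul_pow]
        gcongr
        exact hM q q.2
    _ ≤ ∑' q : J × K, ENNReal.ofReal R ^ 2 * (θ q.1 q.2 ^ 2
          * ENNReal.ofReal (depCoef μX μY pX pY f q ^ 2)) :=
        ENNReal.tsum_comp_le_tsum_of_injective Subtype.val_injective _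
    _ = ENNReal.ofReal R ^ 2 * ∑' j, ∑' k, θ j k ^ 2
          * ENNReal.ofReal (depCoef μX μY pX pY f (j, k) ^ 2) := by
        rw [ENNReal.tsum_mul_left, ENNReal.tsum_prod']
    _ ≤ ENNReal.ofReal R ^ 2 * ENNReal.ofReal r ^ 2 := by gcongr; exact hS
    _ = _ := mul_comm _ _

/-- For alternatives, the truncation to `M` retains most of the dependence. -/
theorem le_tsum_sq_depCoef [Countable J] (hpX : IsL2Basis μX pX) (hpY : IsL2Basis μY pY)
    (hr : 0 < r) (hA : 0 ≤ A) (hR : 0 ≤ R) (hf : f ∈ altClass μX μY pX pY θ r A ρ)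
    (hM : ∀ q ∉ M, ENNReal.ofReal r ≤ ENNReal.ofReal R * θ q.1 q.2) :
    Summable (fun q : M => depCoef μX μY pX pY f q ^ 2) ∧
      ρ ^ 2 - R ^ 2 ≤ ∑' q : M, depCoef μX μY pX pY f q ^ 2 := by
  have hD := (isBoundedDensity_of_mem_altClass hA hf).tsum_sq_depCoef hpX hpY
  have hsplit : ∑' q : M, ENNReal.ofReal (depCoef μX μY pX pY f q ^ 2)
      + ∑' q : ↥Mᶜ, ENNReal.ofReal (depCoef μX μY pX pY f q ^ 2)
      = ENNReal.ofReal (dependence μX μY f) := by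
    rw [← hD]
    exact Summable.tsum_add_tsum_compl (s := M)
      (f := fun q => ENNReal.ofReal (depCoef μX μY pX pY f q ^ 2)) ENNReal.summable
      ENNReal.summable
  have hfin : ∑' q : M, ENNReal.ofReal (depCoef μX μY pX pY f q ^ 2) ≠ ∞ :=
    ne_top_of_le_ne_top ENNReal.ofReal_ne_top (hsplit ▸ le_self_add)
  have hs : Summable (fun q : M => depCoef μX μY pX pY f q ^ 2) := by
    have := ENNReal.summable_toReal hfin
    simpa only [ENNReal.toReal_ofReal (sq_nonneg _)] using this
  refine ⟨hs, ?_⟩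
  have hle := tsum_compl_sq_depCoef_le hr hf hM
  rw [← ENNReal.ofReal_tsum_of_nonneg (fun q => sq_nonneg _) hs] at hsplit
  have h0 : 0 ≤ ∑' q : M, depCoef μX μY pX pY f q ^ 2 := tsum_nonneg fun q => sq_nonneg _
  have h1 : ENNReal.ofReal (dependence μX μY f)
      ≤ ENNReal.ofReal (∑' q : M, depCoef μX μY pX pY f q ^ 2 + R ^ 2) := by
    rw [ENNReal.ofReal_add h0 (sq_nonneg _), ENNReal.ofReal_pow hR, ← hsplit]
    gcongr
  rw [ENNReal.ofReal_le_ofReal_iff (by positivity)] at h1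
  linarith [hf.2.1]

/-- A combination of contrasts is the contrast of the combination, whose L² norm is known from
orthonormality. The constant does not depend on `M`, which is what makes the rate uniform. -/
theorem IsBoundedDensity.integral_sq_sum_contrast_le (hf : IsBoundedDensity μX μY f A)
    (hA : 1 ≤ A) (hpX : IsL2Basis μX pX) (hpY : IsL2Basis μY pY) (N : Finset M) (c : M → ℝ) :
    ∫ u, (∑ q ∈ N, c q * contrast (tensor pX pY q) u) ^ 2 ∂((law μX μY f).prod (law μX μY f))
      ≤ 16 * A ^ 2 * ∑ q ∈ N, c q ^ 2 := by
  classical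
  have hg : MemLp (fun z => ∑ q ∈ N, c q * tensor pX pY q z) 2 (μX.prod μY) :=
    memLp_finsetSum _ fun q _ => (memLp_tensor hpX hpY q).const_mul _
  have h := (hf.contrast_sq hA hg).2
  simp_rw [contrast_sum N c fun q : M => tensor pX pY q]
  refine h.trans (le_of_eq ?_)
  congr 1
  let c' : J × K → ℝ := fun q => if h : q ∈ M then c ⟨q, h⟩ else 0
  have hc' : ∀ q : M, c' q = c q := fun q => by simp [c']
  have h2 := integral_sq_sum_tensor hpX hpY (N.map (Function.Embedding.subtype _)) c'
  simpa only [Finset.sum_map, Function.Embedding.subtype_apply, hc'] using h2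

/-- The kernel of the test statistic truncated to `M`, for a density in the class of
alternatives. -/
theorem IsBoundedDensity.kernelBounds [Countable J] [Countable K]
    (hf : IsBoundedDensity μX μY f A) (hA : 1 ≤ A)
    (hpX : IsL2Basis μX pX) (hpY : IsL2Basis μY pY)
    (hs : Summable fun q : M => depCoef μX μY pX pY f q ^ 2) {s : ℝ} (hs0 : 0 ≤ s)
    (hM : kernelSupNorm pX pY M ≤ ENNReal.ofReal s ∨ (M.encard : ℝ≥0∞) ≤ ENNReal.ofReal (s ^ 2)) :
    KernelBounds ((law μX μY f).prod (law μX μY f))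
      (featureKernel fun q : M => contrast (tensor pX pY q))
      (4 * ∑' q : M, depCoef μX μY pX pY f q ^ 2) (16 * A ^ 2) (256 * A ^ 4 * s ^ 2) := by
  have := hf.isDensity.isProbabilityMeasure_law
  have hint : ∀ q : M, (∫ u, contrast (tensor pX pY q) u
      ∂((law μX μY f).prod (law μX μY f))) ^ 2 = 4 * depCoef μX μY pX pY f q ^ 2 := fun q => by
    rw [hf.integral_contrast hA hpX hpY]; ring
  have hmem : ∀ q : M, MemLp (contrast (tensor pX pY q)) 2
      ((law μX μY f).prod (law μX μY f)) := fun q =>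
    (hf.contrast_sq hA (memLp_tensor hpX hpY q)).1
  have hop := hf.integral_sq_sum_contrast_le (M := M) hA hpX hpY
  rcases hM with hM | hM
  · have hb := featureKernel_contrast_bound hs0 hM
    have hk := kernelBounds_of_bounded _
      (fun q : M => measurable_contrast (measurable_tensor hpX hpY q)) hmem hop (B := 16 * s)
      (fun u => by simpa only [sq] using (hb u u).1)
      (fun u => by simpa only [sq] using (abs_le.1 (hb u u).2).2)
      (by simp_rw [hint]; exact hs.mul_left 4)
    simp_rw [hint, tsum_mul_left] at hk
    refine ⟨hk.memLp, hk.memLp_right, hk.integral_eq, hk.projection_le, hk.sq_le.trans ?_⟩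
    have : 1 ≤ A ^ 4 := one_le_pow₀ hA
    nlinarith [sq_nonneg s]
  · have hfin : M.Finite := by
      rw [← Set.encard_ne_top_iff]
      intro h
      rw [h] at hM
      simp at hM
    have := hfin.fintype
    have hk := kernelBounds_of_fintype _ hmem (by positivity) hop
    simp_rw [hint, tsum_mul_left] at hk
    refine ⟨hk.memLp, hk.memLp_right, hk.integral_eq, hk.projection_le, hk.sq_le.trans ?_⟩
    have hcard : (Fintype.card M : ℝ) ≤ s ^ 2 := by
      rw [Set.encard_eq_coe_toFinset_card, Set.toFinset_card, ENat.toENNReal_coe,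
        ← ENNReal.ofReal_natCast] at hM
      exact (ENNReal.ofReal_le_ofReal_iff (sq_nonneg s)).1 hM
    calc (16 * A ^ 2) ^ 2 * (Fintype.card M : ℝ) ≤ (16 * A ^ 2) ^ 2 * s ^ 2 := by gcongr
      _ = _ := by ring

/-- With s = R²n ≥ 1, the choice of C gives αβmκ ≥ 512A²s. The two terms in the parenthesis are then
at most αβ/1024 and αβ/16, for a total of 65β/128. -/
theorem typeII_arith {α β A C R n m κ e c : ℝ} (hα : 0 < α) (hβ : 0 < β)
    (hαβ : α + β < 1) (hA : 1 ≤ A) (hC : C ^ 2 * (α * β) = 2048 * A ^ 2) (hm : 0 < m)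
    (hmn : n ≤ 8 * m) (hRn : 1 ≤ R ^ 2 * n) (hκ : 2 * (C ^ 2 * R ^ 2) ≤ κ) (hκ0 : 0 < κ)
    (he : e ≤ 256 * A ^ 4 * (R ^ 2 * n) ^ 2) (hc : c ≤ 16 * A ^ 2 * κ) :
    8 / α * (e / (m ^ 2 * κ ^ 2) + 2 * c / (m * κ ^ 2)) ≤ β := by
  set s := R ^ 2 * n with hs
  have hab : 0 < α * β := mul_pos hα hβ
  have hab1 : α * β ≤ 1 := by nlinarith
  have hA2 : 0 < A ^ 2 := by positivity
  have ht : 512 * A ^ 2 * s ≤ α * β * (m * κ) := by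
    have h1 : n * (2 * (C ^ 2 * R ^ 2)) ≤ 8 * m * κ :=
      mul_le_mul hmn hκ (by positivity) (by positivity)
    have h2 : α * β * (n * (2 * (C ^ 2 * R ^ 2))) = 4096 * A ^ 2 * s := by
      rw [hs]; linear_combination 2 * n * R ^ 2 * hC
    nlinarith [mul_le_mul_of_nonneg_left h1 hab.le]
  have ht0 : 0 < m * κ := mul_pos hm hκ0
  have h1 : e / (m ^ 2 * κ ^ 2) ≤ (α * β) ^ 2 / 1024 := by
    rw [div_le_iff₀ (by positivity)]
    have h3 : (512 * A ^ 2 * s) ^ 2 ≤ (α * β * (m * κ)) ^ 2 :=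
      pow_le_pow_left₀ (by positivity) ht 2
    nlinarith
  have h2 : 2 * c / (m * κ ^ 2) ≤ α * β / 16 := by
    rw [div_le_iff₀ (by positivity)]
    have h3 : 512 * A ^ 2 ≤ α * β * (m * κ) := by nlinarith
    nlinarith [mul_le_mul_of_nonneg_right h3 hκ0.le]
  have h4 : (α * β) ^ 2 / 1024 ≤ α * β / 1024 := by nlinarith
  calc _ ≤ 8 / α * (α * β / 1024 + α * β / 16) :=
        mul_le_mul_of_nonneg_left (by linarith) (by positivity)
    _ = 65 / 128 * β := by field_simp; ring
    _ ≤ β := by linarith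

/-- `R` plays the role of the rate: the hypotheses say that it dominates the bias, the parametric
rate and one of the two stochastic terms. Either alternative in `hM` gives a second moment of order
(R²n)² for the kernel. -/
theorem minimaxRisk_le [Countable J] [Countable K] {α β C : ℝ} (hα : 0 < α) (hβ : 0 < β)
    (hαβ : α + β < 1) (hA : 1 ≤ A) (hC : C ^ 2 * (α * β) = 2048 * A ^ 2)
    (hpX : IsL2Basis μX pX) (hpY : IsL2Basis μY pY) (hr : 0 < r) {n : ℕ} (hn : 16 ≤ n)
    (hR : 0 < R) (hRn : 1 ≤ R ^ 2 * n)
    (hθ : ∀ q ∉ M, ENNReal.ofReal r ≤ ENNReal.ofReal R * θ q.1 q.2)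
    (hM : kernelSupNorm pX pY M ≤ ENNReal.ofReal (R ^ 2 * n) ∨
      (M.encard : ℝ≥0∞) ≤ ENNReal.ofReal ((R ^ 2 * n) ^ 2)) :
    minimaxRisk μX μY pX pY θ r A n α (C * R) ≤ α + β := by
  have hab : 0 < α * β := mul_pos hα hβ
  have hab1 : α * β ≤ 1 := by nlinarith
  have hC2 : 2 ≤ C ^ 2 := by nlinarith [sq_nonneg C]
  let k : (X × Y) × (X × Y) → (X × Y) × (X × Y) → ℝ :=
    featureKernel fun q : M => contrast (tensor pX pY q)
  have hsum : ∀ u v, Summable fun q : M =>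
      contrast (tensor pX pY q) u * contrast (tensor pX pY q) v := by
    rcases hM with hM | hM
    · exact fun u v => (featureKernel_contrast_bound (by positivity) hM u v).1
    · have hfin : M.Finite := by
        rw [← Set.encard_ne_top_iff]
        intro h
        rw [h] at hM
        simp at hM
      have := hfin.fintype
      exact fun u v => .of_finite
  have hk : Measurable (Function.uncurry k) := measurable_featureKernel
    (fun q : M => measurable_contrast (measurable_tensor hpX hpY q)) hsum
  have hodd : ∀ u v, k (swapSnd u) v = -k u v := fun u v => by
    simp only [k, featureKernel, contrast_swapSnd, neg_mul, tsum_neg]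
  have hm : 0 < n / 4 := by omega
  obtain ⟨ψ, hψ, hψe⟩ := exists_validTest hk hodd (m := n / 4) (n := n) (by omega) hα
  have hnn : ∀ (φ : validTests X Y n α) (P : Measure (X × Y)),
      0 ≤ expect P fun z => 1 - φ.1 z := fun φ P =>
    integral_nonneg fun z => sub_nonneg.2 (φ.2.2.1 z).2
  rw [minimaxRisk]
  gcongr
  refine ciInf_le_of_le ⟨0, ?_⟩ (⟨ψ, hψ⟩ : validTests X Y n α) ?_
  · rintro _ ⟨φ, rfl⟩
    exact Real.iSup_nonneg fun f => hnn φ _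
  -- Nonnegativity of `β` covers an empty class of alternatives, where the supremum is 0.
  refine Real.iSup_le (fun f => ?_) hβ.le
  have hf := f.2
  have hbd := isBoundedDensity_of_mem_altClass (by linarith) hf
  have := hbd.isDensity.isProbabilityMeasure_law
  obtain ⟨hs, hle⟩ := le_tsum_sq_depCoef hpX hpY hr (by linarith) hR.le hf hθ
  have hkb := hbd.kernelBounds hA hpX hpY hs (by positivity) hM
  set κ := 4 * ∑' q : M, depCoef μX μY pX pY f q ^ 2 with hκ
  -- Since C² ≥ 2, the truncation loss R² is at most half of the separation C²R².
  have hκle : 2 * (C ^ 2 * R ^ 2) ≤ κ := by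
    rw [mul_pow] at hle
    nlinarith [sq_nonneg R]
  have hκ0 : 0 < κ := lt_of_lt_of_le (by positivity) hκle
  rw [hψe]
  refine (measureReal_selfNormalized_ge_le _ hkb.memLp hkb.memLp_right (featureKernel_symm _) hm
    hα (by linarith) hkb.integral_eq hκ0).trans ?_
  refine typeII_arith hα hβ hαβ hA hC (by exact_mod_cast hm) ?_ hRn hκle hκ0 hkb.sq_le
    hkb.projection_le
  -- Rounding n/4 down costs at most a factor of two.
  have : n ≤ 8 * (n / 4) := by omega
  exact_mod_cast this

end Risk

end IndepTest

end

/-! ### The upper bound, translated from extended nonnegative reals to a real rate R for each fixed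
M. -/

theorem theorem2 (α β A : ℝ) (hα : 0 < α) (hβ : 0 < β) (hαβ : α + β < 1) (hA : 1 ≤ A) :
    ∃ C : ℝ, 0 < C ∧
      ∀ (X Y J K : Type*) [MeasurableSpace X] [MeasurableSpace Y] [Countable J] [Countable K]
        (μX : Measure X) (μY : Measure Y) [SigmaFinite μX] [SigmaFinite μY]
        [MeasureTheory.IsSeparable μX] [MeasureTheory.IsSeparable μY]
        (pX : J → X → ℝ) (pY : K → Y → ℝ)
        (_hpX : IndepTest.IsL2Basis μX pX) (_hpY : IndepTest.IsL2Basis μY pY)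
        (θ : J → K → ℝ≥0∞) (r : ℝ) (_hr : 0 < r) (n : ℕ) (_hn : 16 ≤ n),
        IndepTest.separation μX μY pX pY θ r A n α β ≤
          ENNReal.ofReal C * ⨅ M : Set (J × K),
            max (ENNReal.ofReal r / ⨅ q ∈ Mᶜ, θ q.1 q.2)
              (max
                (min (IndepTest.kernelSupNorm pX pY M ^ (1 / 2 : ℝ))
                    ((M.encard : ℝ≥0∞) ^ (1 / 4 : ℝ)) / (n : ℝ≥0∞) ^ (1 / 2 : ℝ))
                (1 / (n : ℝ≥0∞) ^ (1 / 2 : ℝ))) := by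
  have hab : 0 < α * β := mul_pos hα hβ
  have hC2 : Real.sqrt (2048 * A ^ 2 / (α * β)) ^ 2 * (α * β) = 2048 * A ^ 2 := by
    rw [Real.sq_sqrt (by positivity)]
    field_simp
  have hC0 : 0 < Real.sqrt (2048 * A ^ 2 / (α * β)) := Real.sqrt_pos.2 (by positivity)
  refine ⟨_, hC0, ?_⟩
  generalize Real.sqrt (2048 * A ^ 2 / (α * β)) = C at hC2 hC0
  intro X Y J K _ _ _ _ μX μY _ _ _ _ pX pY hpX hpY θ r hr n hn
  rw [ENNReal.mul_iInf_of_ne (by simpa using hC0) ENNReal.ofReal_ne_top]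
  refine le_iInf fun M => ?_
  set E := max (ENNReal.ofReal r / ⨅ q ∈ Mᶜ, θ q.1 q.2)
    (max
      (min (IndepTest.kernelSupNorm pX pY M ^ (1 / 2 : ℝ))
          ((M.encard : ℝ≥0∞) ^ (1 / 4 : ℝ)) / (n : ℝ≥0∞) ^ (1 / 2 : ℝ))
      (1 / (n : ℝ≥0∞) ^ (1 / 2 : ℝ))) with hE
  rcases eq_or_ne E ∞ with htop | htop
  · rw [htop, ENNReal.mul_top (by simpa using hC0)]
    exact le_top
  have h1 : ENNReal.ofReal r / ⨅ q ∈ Mᶜ, θ q.1 q.2 ≤ E := le_max_left _ _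
  have h2 : min (IndepTest.kernelSupNorm pX pY M ^ (1 / 2 : ℝ))
      ((M.encard : ℝ≥0∞) ^ (1 / 4 : ℝ)) / (n : ℝ≥0∞) ^ (1 / 2 : ℝ) ≤ E :=
    (le_max_left _ _).trans (le_max_right _ _)
  have h3 : 1 / (n : ℝ≥0∞) ^ (1 / 2 : ℝ) ≤ E := (le_max_right _ _).trans (le_max_right _ _)
  clear_value E
  have hn0 : (n : ℝ≥0∞) ≠ 0 := by simp; omega
  have hnt : (n : ℝ≥0∞) ≠ ∞ := ENNReal.natCast_ne_top n
  have hs0 : (n : ℝ≥0∞) ^ (1 / 2 : ℝ) ≠ 0 := by simp [hn0]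
  have hst : (n : ℝ≥0∞) ^ (1 / 2 : ℝ) ≠ ∞ := ENNReal.rpow_ne_top_of_nonneg (by norm_num) hnt
  have hss : ((n : ℝ≥0∞) ^ (1 / 2 : ℝ)) ^ 2 = n := by
    rw [← ENNReal.rpow_natCast, ← ENNReal.rpow_mul]; norm_num
  rw [ENNReal.div_le_iff hs0 hst] at h2 h3
  -- The term 1/√n keeps the rate positive even when the other two vanish.
  have hE0 : E ≠ 0 := by
    rintro rfl
    simp at h3
  obtain ⟨R, hR0, rfl⟩ : ∃ R : ℝ, 0 < R ∧ E = ENNReal.ofReal R :=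
    ⟨E.toReal, ENNReal.toReal_pos hE0 htop, (ENNReal.ofReal_toReal htop).symm⟩
  have hRn : (ENNReal.ofReal R * (n : ℝ≥0∞) ^ (1 / 2 : ℝ)) ^ 2 = ENNReal.ofReal (R ^ 2 * n) := by
    rw [mul_pow, hss, ENNReal.ofReal_mul (sq_nonneg R), ENNReal.ofReal_pow hR0.le,
      ENNReal.ofReal_natCast]
  rw [← ENNReal.ofReal_mul hC0.le, IndepTest.separation]
  refine iInf₂_le (C * R) ⟨mul_pos hC0 hR0, ?_⟩
  refine IndepTest.minimaxRisk_le (M := M) hα hβ hαβ hA hC2 hpX hpY hr hn hR0 ?_ ?_ ?_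
  · have := pow_le_pow_left₀ zero_le_one h3 2
    rw [hRn, one_pow, ENNReal.one_le_ofReal] at this
    exact this
  · intro q hq
    have h4 : ENNReal.ofReal r / θ q.1 q.2 ≤ ENNReal.ofReal R :=
      (ENNReal.div_le_div_left (iInf₂_le q hq) _).trans h1
    exact (ENNReal.div_le_iff_le_mul (Or.inr ENNReal.ofReal_ne_top) (Or.inr hE0)).1 h4
  -- Squaring ‖h_M‖^{1/2} ≤ R√n, or taking the fourth power of |M|^{1/4} ≤ R√n, gives the bounds R²n
  -- and (R²n)².
  · rcases min_le_iff.1 h2 with h4 | h4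
    · left
      have := pow_le_pow_left₀ zero_le h4 2
      rw [hRn, ← ENNReal.rpow_natCast, ← ENNReal.rpow_mul] at this
      norm_num at this
      exact this
    · right
      have := pow_le_pow_left₀ zero_le h4 4
      rw [show 4 = 2 * 2 from rfl, pow_mul (ENNReal.ofReal R * _), hRn, ← ENNReal.rpow_natCast,
        ← ENNReal.rpow_mul, ← ENNReal.ofReal_pow (by positivity)] at this
      norm_num at this
      exact this
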